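/- **Theorem 3.2.** Let $M$ be a smooth manifold of odd dimension and $\mathcal{TM}=TM\oplus T^*M$, with the neutral metric $g((X,\alpha),(Y,\beta))=\tfrac12(\alpha(Y)+\beta(X))$, the length $\|u\|_g=|g(u,u)|^{1/2}$, the induced map $\flat_g:\mathcal{TM}\to\mathcal{TM}^*$, $\flat_g(u)=g(u,\cdot)$, and the Courant bracket $$[\![(X,\alpha),(Y,\beta)]\!]=\bigl([X,Y],\;L_X\beta-L_Y\alpha-\tfrac12 d(i_X\beta-i_Y\alpha)\bigr).$$ Let $\mathcal F$ be a smooth bundle endomorphism of $\mathcal{TM}$ with transpose $\mathcal F^t$ on $\mathcal{TM}^*$, let $\mathcal Z$ be a smooth vector field and $\xi$ a smooth 1-form on $M$, and put $\mathfrak Z(X,\alpha)=(\xi(X)\mathcal Z,\alpha(\mathcal Z)\xi)$ and $$\mathcal N_{\mathcal F}(e_1,e_2)=[\![\mathcal Fe_1,\mathcal Fe_2]\!]-\mathcal F\bigl([\![\mathcal Fe_1,e_2]\!]+[\![e_1,\mathcal Fe_2]\!]\bigr)+\mathcal F^2[\![e_1,e_2]\!].$$ The triple $(\mathcal F,\mathcal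 Z,\xi)$ is a *generalized almost para-contact structure* if $g(\mathcal Fu,v)+g(u,\mathcal Fv)=0$ for all $u,v$, $\xi(\mathcal Z)=1$, $\mathcal F(\mathcal Z,0)=\mathcal F(0,\xi)=0$ and $\mathcal F^2=\mathcal I-\mathfrak Z$. It is a *generalized normal para-contact structure* if in addition the corresponding translation-invariant generalized almost paracomplex structure $\mathcal J$ on $M\times\mathbb R$, $$\mathcal J\bigl(X+f\tfrac{\partial}{\partial t},\,\alpha+h\,dt\bigr)=\mathcal F(X,\alpha)+h(\mathcal Z,0)-f(0,\xi)+\bigl(-\alpha(\mathcal Z)\tfrac{\partial}{\partial t},\,\xi(X)\,dt\bigr),$$ is integrable, i.e. $[\![\mathcal Je_1,\mathcal Je_2]\!]-\mathcal J([\![\mathcal Je_1,e_2]\!]+[\![e_1,\mathcal Je_2]\!])+[\![e_1,e_2]\!]=0$ for all smooth sections $e_1,e_2$ of $T(M\times\mathbb R)\oplus T^*(M\times\mathbb R)$. Then $(\mathcal F,\mathcal Z,\xi)$ is a generalized normal para-contact structure if and only if the following conditions hold. 1. $\mathcal F^2=\mathcal I-\mathfrak Z$, and $\mathcal N_{\mathcal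 F}((X,\alpha),(Y,\beta))=-\mathfrak Z[\![(X,\alpha),(Y,\beta)]\!]$ for all $(X,\alpha),(Y,\beta)\in\Gamma(\operatorname{im}\mathcal F)$. 2. $\|\mathcal Z\oplus\xi\|_g=1$, and $[\![(\mathcal Z,0),\mathcal F(X,\alpha)]\!]=\mathcal F(L_{\mathcal Z}X,L_{\mathcal Z}\alpha)$ for all $(X,\alpha)\in\Gamma(\operatorname{im}\mathcal F)$. 3. $\flat_g\circ\mathcal F+\mathcal F^t\circ\flat_g=0$, $\mathcal F\circ\mathfrak Z=0$, and $[\![\mathcal F(X,\alpha),(0,\xi)]\!]=\mathcal F(0,L_X\xi)$ for all $(X,\alpha)\in\Gamma(\operatorname{im}\mathcal F)$. Here $\Gamma(\operatorname{im}\mathcal F)$ denotes the smooth sections of $\mathcal{TM}$ with values in the image of $\mathcal F$. -/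

import Mathlib

open scoped Manifold ContDiff Bundle

noncomputable section

namespace GenParacontact

section Courant

variable {E : Type*} [NormedAddCommGroup E] [NormedSpace ℝ E]
  {H : Type*} [TopologicalSpace H] (I : ModelWithCorners ℝ E H)
  {M : Type*} [TopologicalSpace M] [ChartedSpace H M]

/-- The cotangent space of `M` at `x`. -/
abbrev CotangentSpace (x : M) : Type _ := TangentSpace I x →L[ℝ] ℝ

/-- The fibre at `x` of the big tangent bundle `TM ⊕ T*M`. -/
abbrev BigTangent (x : M) : Type _ := TangentSpace I x × CotangentSpace I x

/-- Smoothness of a section of `TM ⊕ T*M`, the direct sum of the tangent bundle and of its dual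
(the bundle of continuous linear maps into the trivial line bundle). -/
def IsSmoothSection [IsManifold I ∞ M] (e : ∀ x : M, BigTangent I x) : Prop :=
  ContMDiff I (I.prod 𝓘(ℝ, E × (E →L[ℝ] ℝ))) ∞
    (fun x => Bundle.TotalSpace.mk' (E × (E →L[ℝ] ℝ)) (E := fun y : M => BigTangent I y) x (e x))

/-- Smoothness of a bundle endomorphism of `TM ⊕ T*M` over the identity of `M`, seen as a section
of the bundle `Hom (TM ⊕ T*M, TM ⊕ T*M)`. -/
def IsSmoothEndo [IsManifold I ∞ M] (A : ∀ x : M, BigTangent I x →L[ℝ] BigTangent I x) : Prop :=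
  ContMDiff I (I.prod 𝓘(ℝ, (E × (E →L[ℝ] ℝ)) →L[ℝ] (E × (E →L[ℝ] ℝ)))) ∞
    (fun x => Bundle.TotalSpace.mk' ((E × (E →L[ℝ] ℝ)) →L[ℝ] (E × (E →L[ℝ] ℝ)))
      (E := fun y : M => BigTangent I y →L[ℝ] BigTangent I y) x (A x))

/-- The differential `df` of a real function. -/
def differential (f : M → ℝ) (x : M) : CotangentSpace I x :=
  mfderiv I 𝓘(ℝ, ℝ) f x

/-- The 1-form `α` read in the preferred chart at `x₀`: its pullback by the inverse of the chart. -/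
def oneFormInChart (α : ∀ x : M, CotangentSpace I x) (x₀ : M) : E → E →L[ℝ] ℝ := fun y =>
  (α ((extChartAt I x₀).symm y)).comp
    (mfderivWithin 𝓘(ℝ, E) I (extChartAt I x₀).symm (Set.range I) y)

/-- The exterior derivative of a 1-form, `dα (X, Y) = X (α Y) - Y (α X) - α [X, Y]`, computed in
the preferred chart: there `(dα)(u, v) = (∂_u α)(v) - (∂_v α)(u)`. The 1-form
`extD I α x u` is the interior product `i_u dα` at `x`. -/
def extD (α : ∀ x : M, CotangentSpace I x) (x : M)
    (u : TangentSpace I x) : CotangentSpace I x :=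
  let φ : TangentSpace I x →L[ℝ] E := mfderiv I 𝓘(ℝ, E) (extChartAt I x) x
  let D : E →L[ℝ] E →L[ℝ] ℝ :=
    fderivWithin ℝ (oneFormInChart I α x) (Set.range I) (extChartAt I x x)
  (D (φ u) - D.flip (φ u)).comp φ

/-- The Lie derivative of a 1-form along a vector field, by Cartan's formula
`L_X β = i_X dβ + d (i_X β)`. -/
def lieForm (X : ∀ x : M, TangentSpace I x) (β : ∀ x : M, CotangentSpace I x) (x : M) :
    CotangentSpace I x :=
  extD I β x (X x) + differential I (fun y => β y (X y)) x

/-- The Courant bracket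
`⟦(X, α), (Y, β)⟧ = [X, Y] + L_X β - L_Y α - ½ d (i_X β - i_Y α)`. -/
def courant (e₁ e₂ : ∀ x : M, BigTangent I x) (x : M) : BigTangent I x :=
  (VectorField.mlieBracket I (fun y => (e₁ y).1) (fun y => (e₂ y).1) x,
    lieForm I (fun y => (e₁ y).1) (fun y => (e₂ y).2) x
      - lieForm I (fun y => (e₂ y).1) (fun y => (e₁ y).2) x
      - (1 / 2 : ℝ) •
        differential I (fun y => (e₂ y).2 (e₁ y).1 - (e₁ y).2 (e₂ y).1) x)

/-- The componentwise Lie derivative `(L_Z X, L_Z α)`, where `L_Z X = [Z, X]`. -/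
def lieBig (Z : ∀ x : M, TangentSpace I x) (e : ∀ x : M, BigTangent I x) (x : M) :
    BigTangent I x :=
  (VectorField.mlieBracket I Z (fun y => (e y).1) x, lieForm I Z (fun y => (e y).2) x)

/-- The section `A e` for a bundle endomorphism `A` and a section `e`. -/
def applyEndo (A : ∀ x : M, BigTangent I x →L[ℝ] BigTangent I x)
    (e : ∀ x : M, BigTangent I x) (x : M) : BigTangent I x :=
  A x (e x)

/-- The Nijenhuis operator
`N_A (e₁, e₂) = ⟦A e₁, A e₂⟧ - A (⟦A e₁, e₂⟧ + ⟦e₁, A e₂⟧) + A² ⟦e₁, e₂⟧`. -/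
def nijenhuis (A : ∀ x : M, BigTangent I x →L[ℝ] BigTangent I x)
    (e₁ e₂ : ∀ x : M, BigTangent I x) (x : M) : BigTangent I x :=
  courant I (applyEndo I A e₁) (applyEndo I A e₂) x
    - A x (courant I (applyEndo I A e₁) e₂ x + courant I e₁ (applyEndo I A e₂) x)
    + A x (A x (courant I e₁ e₂ x))

/-- The paracomplex integrability condition: `⟦J e₁, J e₂⟧ - J (⟦J e₁, e₂⟧ + ⟦e₁, J e₂⟧) + ⟦e₁, e₂⟧`
vanishes for all smooth sections `e₁`, `e₂` of the big tangent bundle. -/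
def IsIntegrable [IsManifold I ∞ M] (J : ∀ x : M, BigTangent I x →L[ℝ] BigTangent I x) : Prop :=
  ∀ e₁ e₂ : ∀ x : M, BigTangent I x, IsSmoothSection I e₁ → IsSmoothSection I e₂ → ∀ x : M,
    courant I (applyEndo I J e₁) (applyEndo I J e₂) x
      - J x (courant I (applyEndo I J e₁) e₂ x + courant I e₁ (applyEndo I J e₂) x)
      + courant I e₁ e₂ x = 0

/-- The neutral metric `g ((X, α), (Y, β)) = ½ (α(Y) + β(X))` of `TM ⊕ T*M`. -/
def metric {x : M} (a b : BigTangent I x) : ℝ :=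
  (1 / 2) * (a.2 b.1 + b.2 a.1)

/-- The length `‖a‖_g = |g (a, a)|^½` with respect to the neutral metric. -/
def metricNorm {x : M} (a : BigTangent I x) : ℝ :=
  Real.sqrt |metric I a a|

/-- Evaluation of covectors at a tangent vector, `α ↦ α(v)`. -/
def evalAt {x : M} (v : TangentSpace I x) : CotangentSpace I x →L[ℝ] ℝ :=
  (ContinuousLinearMap.apply ℝ ℝ : E →L[ℝ] (E →L[ℝ] ℝ) →L[ℝ] ℝ) v

@[simp] theorem evalAt_apply {x : M} (v : TangentSpace I x) (α : CotangentSpace I x) :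
    evalAt I v α = α v := rfl

/-- The isomorphism `♭_g` from `TM ⊕ T*M` to its dual: `♭_g a = g (a, ·)`. -/
def flat {x : M} (a : BigTangent I x) : BigTangent I x →L[ℝ] ℝ :=
  (1 / 2 : ℝ) • (a.2.comp (ContinuousLinearMap.fst ℝ _ _)
    + (evalAt I a.1).comp (ContinuousLinearMap.snd ℝ _ _))

theorem flat_apply {x : M} (a b : BigTangent I x) : flat I a b = metric I a b := by
  simp [flat, metric, mul_add]

/-- The transpose `A^t φ = φ ∘ A` of an endomorphism of a fibre, acting on the dual fibre. -/
def transpose {x : M} (A : BigTangent I x →L[ℝ] BigTangent I x) (φ : BigTangent I x →L[ℝ] ℝ) :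
    BigTangent I x →L[ℝ] ℝ :=
  φ.comp A

/-- The endomorphism `𝔷 = Z ⊙ ξ` of `TM ⊕ T*M`: `𝔷 (X, α) = (ξ(X) Z, α(Z) ξ)`. -/
def frakZ (Z : ∀ x : M, TangentSpace I x) (ξ : ∀ x : M, CotangentSpace I x) (x : M) :
    BigTangent I x →L[ℝ] BigTangent I x :=
  ((ξ x).smulRight (Z x)).prodMap ((evalAt I (Z x)).smulRight (ξ x))

theorem frakZ_apply (Z : ∀ x : M, TangentSpace I x) (ξ : ∀ x : M, CotangentSpace I x) (x : M)
    (a : BigTangent I x) : frakZ I Z ξ x a = (ξ x a.1 • Z x, a.2 (Z x) • ξ x) := by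
  rfl

/-- Smooth sections of the image of a bundle endomorphism. -/
def IsSectionOfImage [IsManifold I ∞ M] (A : ∀ x : M, BigTangent I x →L[ℝ] BigTangent I x)
    (e : ∀ x : M, BigTangent I x) : Prop :=
  IsSmoothSection I e ∧ ∀ x, e x ∈ Set.range (A x)

/-- `(F, Z, ξ)` is a generalized almost para-contact structure: `F + F* = 0` (adjoint with respect
to the neutral metric), `ξ(Z) = 1`, `F ξ = 0`, `F Z = 0` and `F² = I - Z ⊙ ξ`. -/
structure IsAlmostParacontact [IsManifold I ∞ M]
    (F : ∀ x : M, BigTangent I x →L[ℝ] BigTangent I x)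
    (Z : ∀ x : M, TangentSpace I x) (ξ : ∀ x : M, CotangentSpace I x) : Prop where
  smooth_endo : IsSmoothEndo I F
  smooth_section : IsSmoothSection I (fun x => (Z x, ξ x))
  skew : ∀ x (a b : BigTangent I x), metric I (F x a) b + metric I a (F x b) = 0
  pairing : ∀ x, ξ x (Z x) = 1
  apply_form : ∀ x, F x (0, ξ x) = 0
  apply_vector : ∀ x, F x (Z x, 0) = 0
  sq : ∀ x, (F x).comp (F x) = ContinuousLinearMap.id ℝ _ - frakZ I Z ξ x

end Courant

section Product

variable {E : Type*} [NormedAddCommGroup E] [NormedSpace ℝ E]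
  {H : Type*} [TopologicalSpace H] (I : ModelWithCorners ℝ E H)
  {M : Type*} [TopologicalSpace M] [ChartedSpace H M]

/-- The tangent space of `M × ℝ` at `p` is `T_{p.1} M × ℝ`. This is the projection
`(X + f ∂_t, α + g dt) ↦ (X, α)` of the big tangent space of `M × ℝ` to that of `M`. -/
def projBig (p : M × ℝ) :
    BigTangent (I.prod 𝓘(ℝ, ℝ)) p →L[ℝ] BigTangent I p.1 :=
  ContinuousLinearMap.prodMap (ContinuousLinearMap.fst ℝ E ℝ)
    ((ContinuousLinearMap.inl ℝ E ℝ).precomp ℝ)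

/-- The inclusion `(X, α) ↦ (X + 0 ∂_t, α + 0 dt)`. -/
def inclBig (p : M × ℝ) :
    BigTangent I p.1 →L[ℝ] BigTangent (I.prod 𝓘(ℝ, ℝ)) p :=
  ContinuousLinearMap.prodMap (ContinuousLinearMap.inl ℝ E ℝ)
    ((ContinuousLinearMap.fst ℝ E ℝ).precomp ℝ)

/-- The vector `∂_t = d/dt` of `M × ℝ`, in the big tangent space. -/
def bigDdt (p : M × ℝ) : BigTangent (I.prod 𝓘(ℝ, ℝ)) p :=
  (((0, 1) : E × ℝ), 0)

/-- The covector `dt` of `M × ℝ`, in the big tangent space. -/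
def bigDt (p : M × ℝ) : BigTangent (I.prod 𝓘(ℝ, ℝ)) p :=
  (0, ContinuousLinearMap.snd ℝ E ℝ)

/-- The functional `(X + f ∂_t, α + g dt) ↦ f`. -/
def coeffDdt (p : M × ℝ) : BigTangent (I.prod 𝓘(ℝ, ℝ)) p →L[ℝ] ℝ :=
  (ContinuousLinearMap.snd ℝ E ℝ).comp (ContinuousLinearMap.fst ℝ (E × ℝ) ((E × ℝ) →L[ℝ] ℝ))

/-- The functional `(X + f ∂_t, α + g dt) ↦ g`. -/
def coeffDt (p : M × ℝ) : BigTangent (I.prod 𝓘(ℝ, ℝ)) p →L[ℝ] ℝ :=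
  (ContinuousLinearMap.apply ℝ ℝ ((0, 1) : E × ℝ)).comp
    (ContinuousLinearMap.snd ℝ (E × ℝ) ((E × ℝ) →L[ℝ] ℝ))

/-- The generalized almost paracomplex structure on `M × ℝ` that corresponds to `(F, Z, ξ)`. It is
invariant under translations of `t`, and
`J (X + f ∂_t, α + g dt) = F (X, α) + g (Z, 0) - f (0, ξ) + (-α(Z) ∂_t, ξ(X) dt)`.
In terms of classical tensors, `F = (a, P, σ)` is replaced by `(a, P - Z ∧ ∂_t, σ + ξ ∧ dt)`. With
these signs `J` is skew for the neutral metric and `J² = I`, `J ∂_t = -ξ` and `J dt = Z`; the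
variant with `J ∂_t = ξ` and `J dt = -Z` is the image of this one under `t ↦ -t`. -/
def productEndo (F : ∀ x : M, BigTangent I x →L[ℝ] BigTangent I x)
    (Z : ∀ x : M, TangentSpace I x) (ξ : ∀ x : M, CotangentSpace I x) (p : M × ℝ) :
    BigTangent (I.prod 𝓘(ℝ, ℝ)) p →L[ℝ] BigTangent (I.prod 𝓘(ℝ, ℝ)) p :=
  (inclBig I p).comp ((F p.1).comp (projBig I p))
    + (coeffDt I p).smulRight (inclBig I p (Z p.1, 0))
    - (coeffDdt I p).smulRight (inclBig I p (0, ξ p.1))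
    - (((evalAt I (Z p.1)).comp
        ((ContinuousLinearMap.snd ℝ _ _).comp (projBig I p))).smulRight (bigDdt I p))
    + (((ξ p.1).comp ((ContinuousLinearMap.fst ℝ _ _).comp (projBig I p))).smulRight (bigDt I p))

/-- `(F, Z, ξ)` is a generalized normal para-contact structure: it is a generalized almost
para-contact structure and the corresponding generalized almost paracomplex structure on `M × ℝ` is
integrable. -/
def IsNormalParacontact [IsManifold I ∞ M]
    (F : ∀ x : M, BigTangent I x →L[ℝ] BigTangent I x)
    (Z : ∀ x : M, TangentSpace I x) (ξ : ∀ x : M, CotangentSpace I x) : Prop :=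
  IsAlmostParacontact I F Z ξ ∧ IsIntegrable (I.prod 𝓘(ℝ, ℝ)) (productEndo I F Z ξ)

end Product

end GenParacontact

end

/-! The algebraic half is pointwise. The norm condition gives only `|ξ(Z)| = 1`, but then `F ∘ 𝔷 =
0` kills `(Z, 0)` and `(0, ξ)`, and `F² = I - 𝔷` evaluated at `(Z, 0)` forces `ξ(Z) = 1`
(`isAlmostParacontact_iff`).

For integrability, `J` on `M × ℝ` is skew with `J² = I`. For such `J` the torsion is a tensor `T`,
antisymmetric, with `T(Ja, b) = -J T(a, b)` (`exists_torsionTensor`). In a chart the Courant bracket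
depends only on first jets, and the derivative terms cancel by skewness and `J² = I`. Hence `T`
vanishes as soon as it vanishes on pairs from a set whose `J`-stable span is everything: `im F`,
`-∂_t` and `dt`, since `J(-∂_t) = ξ`, `J dt = Z` and `TM ⊕ T*M` is spanned by `im F`, `Z` and `ξ`
(`bilinear_eq_zero`).

On translation-invariant sections, `T` is computed by brackets on `M`. The pairs (`im F`, `im F`),
(`im F`, `dt`) and (`im F`, `-∂_t`) give the bracket identities of conditions 1, 2 and 3. The `∂_t`
and `dt` components of these equations are automatic: substituting `F e` for `e` shows that the
quantities they test lie in `im F`, which `ξ` and `Z` annihilate. The last pair gives `⟦(0, ξ), (Z,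
0)⟧ = -i_Z dξ`, which vanishes by condition 2: for `X` in `ker ξ`, the bracket identity puts `[X,
Z]` in `ker ξ` (`courant_form_vector`). -/

noncomputable section

namespace GenParacontact

open Set Filter
open scoped Topology

/-! ### Pointwise algebra of the bracket and of the torsion on first jets. -/

section JetAlgebra

variable {E V : Type*} [NormedAddCommGroup E] [NormedSpace ℝ E] [NormedAddCommGroup V]
  [NormedSpace ℝ V] (ρ : V →L[ℝ] E) (ι : (E →L[ℝ] ℝ) →L[ℝ] V) (B : V →ₗ[ℝ] V →L[ℝ] ℝ)

/-- The Courant bracket of two sections of a trivial bundle with fibre `V`, anchor `ρ`, coanchor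
`ι` and metric `B`, in terms of their values `a`, `b` and of their derivatives `L`, `K` at a
point. -/
def jetBracket (a : V) (L : E →L[ℝ] V) (b : V) (K : E →L[ℝ] V) : V :=
  K (ρ a) - L (ρ b) + ι ((B b).comp L - (B a).comp K)

theorem jetBracket_swap (a b : V) (L K : E →L[ℝ] V) :
    jetBracket ρ ι B a L b K = -jetBracket ρ ι B b K a L := by
  simp only [jetBracket, map_sub]
  abel

theorem jetBracket_add_left (a a' b : V) (L L' K : E →L[ℝ] V) :
    jetBracket ρ ι B (a + a') (L + L') b K
      = jetBracket ρ ι B a L b K + jetBracket ρ ι B a' L' b K := by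
  simp only [jetBracket, map_add, add_apply, map_sub,
    ContinuousLinearMap.comp_add, ContinuousLinearMap.add_comp]
  abel

theorem jetBracket_smul_left (c : ℝ) (a b : V) (L K : E →L[ℝ] V) :
    jetBracket ρ ι B (c • a) (c • L) b K = c • jetBracket ρ ι B a L b K := by
  simp only [jetBracket, map_smul, smul_apply, map_sub,
    ContinuousLinearMap.comp_smul, ContinuousLinearMap.smul_comp, smul_add, smul_sub]

/-- The expression `⟦J e₁, J e₂⟧ - J (⟦J e₁, e₂⟧ + ⟦e₁, J e₂⟧) + ⟦e₁, e₂⟧` at a point, in terms of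
the values and the derivatives of `J`, `e₁` and `e₂` there. -/
def jetTorsion (J : V →L[ℝ] V) (D : E →L[ℝ] V →L[ℝ] V) (a : V) (L : E →L[ℝ] V) (b : V)
    (K : E →L[ℝ] V) : V :=
  jetBracket ρ ι B (J a) (J.comp L + D.flip a) (J b) (J.comp K + D.flip b)
    - J (jetBracket ρ ι B (J a) (J.comp L + D.flip a) b K
      + jetBracket ρ ι B a L (J b) (J.comp K + D.flip b))
    + jetBracket ρ ι B a L b K

theorem jetTorsion_swap (J : V →L[ℝ] V) (D : E →L[ℝ] V →L[ℝ] V) (a b : V)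
    (L K : E →L[ℝ] V) : jetTorsion ρ ι B J D a L b K = -jetTorsion ρ ι B J D b K a L := by
  simp only [jetTorsion]
  rw [jetBracket_swap ρ ι B (J a) (J b), jetBracket_swap ρ ι B (J a) b,
    jetBracket_swap ρ ι B a (J b), jetBracket_swap ρ ι B a b]
  simp only [map_add, map_neg]
  abel

theorem jetTorsion_add_left (J : V →L[ℝ] V) (D : E →L[ℝ] V →L[ℝ] V) (a a' b : V)
    (L L' K : E →L[ℝ] V) :
    jetTorsion ρ ι B J D (a + a') (L + L') b K
      = jetTorsion ρ ι B J D a L b K + jetTorsion ρ ι B J D a' L' b K := by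
  have h : J.comp (L + L') + D.flip (a + a')
      = (J.comp L + D.flip a) + (J.comp L' + D.flip a') := by
    rw [ContinuousLinearMap.comp_add, map_add]; abel
  simp only [jetTorsion]
  rw [h]
  simp only [map_add J, jetBracket_add_left]
  abel

theorem jetTorsion_smul_left (J : V →L[ℝ] V) (D : E →L[ℝ] V →L[ℝ] V) (c : ℝ) (a b : V)
    (L K : E →L[ℝ] V) :
    jetTorsion ρ ι B J D (c • a) (c • L) b K = c • jetTorsion ρ ι B J D a L b K := by
  have h : J.comp (c • L) + D.flip (c • a) = c • (J.comp L + D.flip a) := by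
    rw [ContinuousLinearMap.comp_smul, map_smul, smul_add]
  simp only [jetTorsion]
  rw [h, map_smul J c a]
  simp only [jetBracket_smul_left]
  simp only [map_add J, map_smul J, smul_add, smul_sub]

variable {ρ ι B}

/-- At a zero of `e₁` the derivatives of `J` and of `e₂` drop out and only terms in `L` survive. The
anchor terms cancel in pairs by `J² = I`; the metric terms cancel after skewness moves `J` across
`B`. -/
theorem jetTorsion_zero_left {J : V →L[ℝ] V}
    (hskew : ∀ a b, B (J a) b = -B a (J b)) (hsq : ∀ a, J (J a) = a)
    (D : E →L[ℝ] V →L[ℝ] V) (L : E →L[ℝ] V) (b : V) (K : E →L[ℝ] V) :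
    jetTorsion ρ ι B J D 0 L b K = 0 := by
  have key (M N : E →L[ℝ] V) (c : V) :
      jetBracket ρ ι B 0 M c N = -M (ρ c) + ι ((B c).comp M) := by
    simp [jetBracket]
  have h1 : (B (J b)).comp (J.comp L) = -(B b).comp L := by
    ext v; simp [hskew, hsq]
  have h2 : (B (J b)).comp L = -(B b).comp (J.comp L) := by
    ext v; simp [hskew]
  simp only [jetTorsion, map_zero, add_zero, key, h1, h2, map_add, map_neg,
    ContinuousLinearMap.comp_apply, hsq]
  abel

/-- Tensoriality: split `(a, L) = (a, 0) + (0, L)`, discard the second jet, and use antisymmetry to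
treat the other slot. -/
theorem jetTorsion_eq_zero_jets {J : V →L[ℝ] V}
    (hskew : ∀ a b, B (J a) b = -B a (J b)) (hsq : ∀ a, J (J a) = a)
    (D : E →L[ℝ] V →L[ℝ] V) (a : V) (L : E →L[ℝ] V) (b : V)
    (K : E →L[ℝ] V) : jetTorsion ρ ι B J D a L b K = jetTorsion ρ ι B J D a 0 b 0 := by
  have h (a : V) (L : E →L[ℝ] V) (b : V) (K : E →L[ℝ] V) :
      jetTorsion ρ ι B J D a L b K = jetTorsion ρ ι B J D a 0 b K := by
    have := jetTorsion_add_left ρ ι B J D a 0 b 0 L K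
    rwa [add_zero, zero_add, jetTorsion_zero_left hskew hsq, add_zero] at this
  rw [h, jetTorsion_swap, h, ← jetTorsion_swap]

end JetAlgebra

/-- The metric `½ (α(Y) + β(X))` of `E × E*`, as a map to the dual. -/
def modelFlat (E : Type*) [NormedAddCommGroup E] [NormedSpace ℝ E] :
    (E × (E →L[ℝ] ℝ)) →ₗ[ℝ] (E × (E →L[ℝ] ℝ)) →L[ℝ] ℝ where
  toFun a := (1 / 2 : ℝ) • (a.2.comp (ContinuousLinearMap.fst ℝ _ _)
    + (ContinuousLinearMap.apply ℝ ℝ a.1).comp (ContinuousLinearMap.snd ℝ _ _))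
  map_add' a b := by
    refine ContinuousLinearMap.ext fun v => ?_
    change 1 / 2 * ((a.2 v.1 + b.2 v.1) + v.2 (a.1 + b.1))
      = 1 / 2 * (a.2 v.1 + v.2 a.1) + 1 / 2 * (b.2 v.1 + v.2 b.1)
    rw [map_add]; ring
  map_smul' c a := by
    refine ContinuousLinearMap.ext fun v => ?_
    change 1 / 2 * (c * a.2 v.1 + v.2 (c • a.1)) = c * (1 / 2 * (a.2 v.1 + v.2 a.1))
    rw [map_smul, smul_eq_mul]; ring

/-- The Courant bracket over a normed space `E`, in terms of values and derivatives at a point. -/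
abbrev modelBracket {E : Type*} [NormedAddCommGroup E] [NormedSpace ℝ E]
    (a : E × (E →L[ℝ] ℝ)) (L : E →L[ℝ] E × (E →L[ℝ] ℝ)) (b : E × (E →L[ℝ] ℝ))
    (K : E →L[ℝ] E × (E →L[ℝ] ℝ)) : E × (E →L[ℝ] ℝ) :=
  jetBracket (ContinuousLinearMap.fst ℝ E (E →L[ℝ] ℝ)) (ContinuousLinearMap.inr ℝ E (E →L[ℝ] ℝ))
    (modelFlat E) a L b K

/-! ### Sections of `TM ⊕ T*M` read in a chart. -/

section LocalRepresentation

variable {E : Type*} [NormedAddCommGroup E] [NormedSpace ℝ E]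
  {H : Type*} [TopologicalSpace H] (I : ModelWithCorners ℝ E H)
  {M : Type*} [TopologicalSpace M] [ChartedSpace H M]

/-- An element of the fibre at `y` of the big tangent bundle, read in the preferred chart
at `x₀`. -/
def readFibre [IsManifold I ∞ M] (x₀ y : M) (v : BigTangent I y) : E × (E →L[ℝ] ℝ) :=
  ((trivializationAt E (TangentSpace I) x₀).continuousLinearMapAt ℝ y v.1,
    v.2.comp ((trivializationAt E (TangentSpace I) x₀).symmL ℝ y))

/-- A section of the big tangent bundle, read in the preferred chart at `x₀`. -/
def localRep [IsManifold I ∞ M] (x₀ : M) (e : ∀ x : M, BigTangent I x) (z : E) :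
    E × (E →L[ℝ] ℝ) :=
  readFibre I x₀ ((extChartAt I x₀).symm z) (e ((extChartAt I x₀).symm z))

/-- Differentiability at `x` of a section, read in the preferred chart at `x`. -/
def DiffAt [IsManifold I ∞ M] (e : ∀ x : M, BigTangent I x) (x : M) : Prop :=
  DifferentiableAt ℝ (localRep I x e) (extChartAt I x x)

/-- The derivative at `x` of a section, read in the preferred chart at `x`. -/
def jet [IsManifold I ∞ M] (e : ∀ x : M, BigTangent I x) (x : M) : E →L[ℝ] E × (E →L[ℝ] ℝ) :=
  fderiv ℝ (localRep I x e) (extChartAt I x x)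

variable [IsManifold I ∞ M]

/-- The coordinate change of the preferred chart with itself is the identity, so at the base point a
section and its representative have the same value and no Jacobian appears in the formulas below. -/
theorem readFibre_self (x : M) (v : BigTangent I x) : readFibre I x x v = v := by
  have h1 : (trivializationAt E (TangentSpace I) x).continuousLinearMapAt ℝ x
      = ContinuousLinearMap.id ℝ E := by
    rw [TangentBundle.continuousLinearMapAt_trivializationAt_eq_core (mem_chart_source H x)]
    ext w
    exact (tangentBundleCore I M).coordChange_self (achart H x) x (mem_chart_source H x) w
  have h2 : (trivializationAt E (TangentSpace I) x).symmL ℝ x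
      = ContinuousLinearMap.id ℝ E := by
    rw [TangentBundle.symmL_trivializationAt_eq_core (mem_chart_source H x)]
    ext w
    exact (tangentBundleCore I M).coordChange_self (achart H x) x (mem_chart_source H x) w
  rw [readFibre, h1, h2]
  rfl

theorem localRep_self (x : M) (e : ∀ x : M, BigTangent I x) :
    localRep I x e (extChartAt I x x) = e x := by
  rw [localRep, extChartAt_to_inv, readFibre_self]

/-- Links the bundle trivialization that defines smoothness with the explicit `readFibre` used in
computations. -/
theorem trivializationAt_eq_readFibre {x₀ y : M} (hy : y ∈ (chartAt H x₀).source)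
    (v : BigTangent I y) :
    (trivializationAt (E × (E →L[ℝ] ℝ)) (fun y : M => BigTangent I y) x₀ ⟨y, v⟩).2
      = readFibre I x₀ y v := by
  have h : (trivializationAt E (TangentSpace I) x₀ ⟨y, v.1⟩).2
      = (trivializationAt E (TangentSpace I) x₀).continuousLinearMapAt ℝ y v.1 := by
    rw [Bundle.Trivialization.continuousLinearMapAt_apply,
      Bundle.Trivialization.coe_linearMapAt_of_mem _ (by simpa using hy)]
  refine Prod.ext h ?_
  ext w
  change ((Bundle.Trivial.trivialization M ℝ).continuousLinearMapAt ℝ y) _ = _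
  simp [readFibre]

variable [I.Boundaryless]

omit [IsManifold I ∞ M] in
theorem extChartAt_symm_mem_source (x : M) :
    ∀ᶠ z in 𝓝 (extChartAt I x x), (extChartAt I x).symm z ∈ (chartAt H x).source := by
  filter_upwards [extChartAt_target_mem_nhds (I := I) x] with z hz
  rw [← extChartAt_source I]
  exact (extChartAt I x).map_target hz

omit [IsManifold I ∞ M] in
theorem ContMDiffAt.differentiableAt_comp_extChartAt_symm {F : Type*} [NormedAddCommGroup F]
    [NormedSpace ℝ F] {f : M → F} {x : M} (h : ContMDiffAt I 𝓘(ℝ, F) ∞ f x) :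
    DifferentiableAt ℝ (f ∘ (extChartAt I x).symm) (extChartAt I x x) := by
  have := (contMDiffAt_iff.1 h).2
  rw [I.range_eq_univ, contDiffWithinAt_univ] at this
  exact this.differentiableAt (by simp)

theorem IsSmoothSection.diffAt {e : ∀ x : M, BigTangent I x} (he : IsSmoothSection I e) (x : M) :
    DiffAt I e x := by
  have h := (Bundle.contMDiffAt_section (IB := I) x).1 (he x)
  refine (ContMDiffAt.differentiableAt_comp_extChartAt_symm I h).congr_of_eventuallyEq ?_
  filter_upwards [extChartAt_symm_mem_source I x] with z hz
  exact (trivializationAt_eq_readFibre I hz _).symm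

end LocalRepresentation

/-! ### The Courant bracket as a function of first jets. -/

section CourantInChart

variable {E : Type*} [NormedAddCommGroup E] [NormedSpace ℝ E]
  {H : Type*} [TopologicalSpace H] (I : ModelWithCorners ℝ E H)
  {M : Type*} [TopologicalSpace M] [ChartedSpace H M] [IsManifold I ∞ M]

theorem mfderivWithin_extChartAt_symm_eq_symmL {x : M} {z : E}
    (hz : z ∈ (extChartAt I x).target) :
    mfderivWithin 𝓘(ℝ, E) I (extChartAt I x).symm (range I) z
      = (trivializationAt E (TangentSpace I) x).symmL ℝ ((extChartAt I x).symm z) := by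
  have h : (extChartAt I x).symm z ∈ (chartAt H x).source := by
    rw [← extChartAt_source I]; exact (extChartAt I x).map_target hz
  rw [TangentBundle.symmL_trivializationAt h, (extChartAt I x).right_inv hz]

theorem inverse_mfderivWithin_extChartAt_symm {x : M} {z : E}
    (hz : z ∈ (extChartAt I x).target) :
    (mfderivWithin 𝓘(ℝ, E) I (extChartAt I x).symm (range I) z).inverse
      = (trivializationAt E (TangentSpace I) x).continuousLinearMapAt ℝ
          ((extChartAt I x).symm z) := by
  have h : (extChartAt I x).symm z ∈ (chartAt H x).source := by
    rw [← extChartAt_source I]; exact (extChartAt I x).map_target hz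
  rw [TangentBundle.continuousLinearMapAt_trivializationAt h]
  exact ContinuousLinearMap.inverse_eq (mfderivWithin_extChartAt_symm_comp_mfderiv_extChartAt hz)
    (mfderiv_extChartAt_comp_mfderivWithin_extChartAt_symm hz)

theorem mfderiv_extChartAt_self (x : M) :
    mfderiv I 𝓘(ℝ, E) (extChartAt I x) x = ContinuousLinearMap.id ℝ E := by
  rw [← TangentBundle.continuousLinearMapAt_trivializationAt (mem_chart_source H x),
    TangentBundle.continuousLinearMapAt_trivializationAt_eq_core (mem_chart_source H x)]
  ext w
  exact (tangentBundleCore I M).coordChange_self (achart H x) x (mem_chart_source H x) w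

variable [I.Boundaryless]

omit [IsManifold I ∞ M] [I.Boundaryless] in
theorem differential_eq_fderiv {f : M → ℝ} {x : M} {g : E → ℝ}
    (hg : DifferentiableAt ℝ g (extChartAt I x x))
    (hfg : f ∘ (extChartAt I x).symm =ᶠ[𝓝 (extChartAt I x x)] g) :
    differential I f x = fderiv ℝ g (extChartAt I x x) := by
  have hd := hg.congr_of_eventuallyEq hfg
  -- `HasMFDerivAt` also requires continuity on the manifold; it comes from the representative
  -- composed with the chart, which agrees with `f` near `x`.
  have hc : ContinuousAt f x := by
    have h := ContinuousAt.comp (f := extChartAt I x) (x := x) hd.continuousAt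
      (continuousAt_extChartAt x)
    refine h.congr ?_
    filter_upwards [extChartAt_source_mem_nhds (I := I) x] with y hy
    exact congrArg f ((extChartAt I x).left_inv hy)
  have h : HasMFDerivAt I 𝓘(ℝ, ℝ) f x (fderiv ℝ g (extChartAt I x x)) := by
    refine ⟨hc, ?_⟩
    have h := hd.hasFDerivAt.hasFDerivWithinAt (s := range I)
    rwa [hfg.fderiv_eq] at h
  exact h.mfderiv

theorem mpullbackWithin_eventuallyEq (e : ∀ x : M, BigTangent I x) (x : M) :
    VectorField.mpullbackWithin 𝓘(ℝ, E) I (extChartAt I x).symm (fun y => (e y).1) (range I)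
      =ᶠ[𝓝 (extChartAt I x x)] fun z => (localRep I x e z).1 := by
  filter_upwards [extChartAt_target_mem_nhds (I := I) x] with z hz
  rw [VectorField.mpullbackWithin_apply, inverse_mfderivWithin_extChartAt_symm I hz]
  rfl

theorem oneFormInChart_eventuallyEq (e : ∀ x : M, BigTangent I x) (x : M) :
    oneFormInChart I (fun y => (e y).2) x
      =ᶠ[𝓝 (extChartAt I x x)] fun z => (localRep I x e z).2 := by
  filter_upwards [extChartAt_target_mem_nhds (I := I) x] with z hz
  rw [oneFormInChart, mfderivWithin_extChartAt_symm_eq_symmL I hz]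
  rfl

theorem pairing_eventuallyEq (e₁ e₂ : ∀ x : M, BigTangent I x) (x : M) :
    (fun y => (e₂ y).2 (e₁ y).1) ∘ (extChartAt I x).symm
      =ᶠ[𝓝 (extChartAt I x x)] fun z => (localRep I x e₂ z).2 (localRep I x e₁ z).1 := by
  filter_upwards [extChartAt_symm_mem_source I x] with z hz
  simp only [Function.comp_apply, localRep, readFibre, ContinuousLinearMap.comp_apply]
  rw [Bundle.Trivialization.symmL_continuousLinearMapAt _ (by simpa using hz)]

variable {e₁ e₂ : ∀ x : M, BigTangent I x} {x : M}

omit [I.Boundaryless] in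
variable {I} in
theorem DiffAt.fst {e : ∀ x : M, BigTangent I x} (he : DiffAt I e x) :
    HasFDerivAt (fun z => (localRep I x e z).1)
      ((ContinuousLinearMap.fst ℝ E (E →L[ℝ] ℝ)).comp (jet I e x)) (extChartAt I x x) :=
  (ContinuousLinearMap.fst ℝ E (E →L[ℝ] ℝ)).hasFDerivAt.comp _ he.hasFDerivAt

omit [I.Boundaryless] in
variable {I} in
theorem DiffAt.snd {e : ∀ x : M, BigTangent I x} (he : DiffAt I e x) :
    HasFDerivAt (fun z => (localRep I x e z).2)
      ((ContinuousLinearMap.snd ℝ E (E →L[ℝ] ℝ)).comp (jet I e x)) (extChartAt I x x) :=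
  (ContinuousLinearMap.snd ℝ E (E →L[ℝ] ℝ)).hasFDerivAt.comp _ he.hasFDerivAt

omit [I.Boundaryless] in
theorem lieBracketWithin_eq_of_eventuallyEq {X X' Y Y' : E → E} {A B : E →L[ℝ] E} {s : Set E}
    {z : E} (hs : s = univ) (hX : X =ᶠ[𝓝 z] X') (hY : Y =ᶠ[𝓝 z] Y') (hX' : HasFDerivAt X' A z)
    (hY' : HasFDerivAt Y' B z) :
    VectorField.lieBracketWithin ℝ X Y s z = B (X' z) - A (Y' z) := by
  rw [hs, VectorField.lieBracketWithin_univ, hX.lieBracket_vectorField_eq hY,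
    VectorField.lieBracket_eq]
  beta_reduce
  rw [hX'.fderiv, hY'.fderiv]

theorem mlieBracket_eq_jet (h₁ : DiffAt I e₁ x) (h₂ : DiffAt I e₂ x) :
    VectorField.mlieBracket I (fun y => (e₁ y).1) (fun y => (e₂ y).1) x
      = (jet I e₂ x (e₁ x).1).1 - (jet I e₁ x (e₂ x).1).1 := by
  have hb : VectorField.lieBracketWithin ℝ
      (VectorField.mpullbackWithin 𝓘(ℝ, E) I (extChartAt I x).symm (fun y => (e₁ y).1) (range I))
      (VectorField.mpullbackWithin 𝓘(ℝ, E) I (extChartAt I x).symm (fun y => (e₂ y).1) (range I))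
      ((extChartAt I x).symm ⁻¹' univ ∩ range I) (extChartAt I x x)
      = (jet I e₂ x (e₁ x).1).1 - (jet I e₁ x (e₂ x).1).1 := by
    refine (lieBracketWithin_eq_of_eventuallyEq ?_ (mpullbackWithin_eventuallyEq I e₁ x)
      (mpullbackWithin_eventuallyEq I e₂ x) h₁.fst h₂.fst).trans ?_
    · rw [preimage_univ, univ_inter, I.range_eq_univ]
    · rw [localRep_self, localRep_self]
      rfl
  rw [← VectorField.mlieBracketWithin_univ, VectorField.mlieBracketWithin_apply]
  refine Eq.trans ?_ hb
  rw [mfderiv_extChartAt_self]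
  exact congrArg (fun A : E →L[ℝ] E => A _) ContinuousLinearMap.inverse_id

theorem extD_eq_jet (h : DiffAt I e₁ x) (u v : E) :
    extD I (fun y => (e₁ y).2) x u v = (jet I e₁ x u).2 v - (jet I e₁ x v).2 u := by
  have hD : fderivWithin ℝ (oneFormInChart I (fun y => (e₁ y).2) x) (range I) (extChartAt I x x)
      = (ContinuousLinearMap.snd ℝ E (E →L[ℝ] ℝ)).comp (jet I e₁ x) := by
    rw [I.range_eq_univ, fderivWithin_univ, (oneFormInChart_eventuallyEq I e₁ x).fderiv_eq,
      h.snd.fderiv]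
  change (fderivWithin ℝ (oneFormInChart I (fun y => (e₁ y).2) x) (range I) (extChartAt I x x)
      (mfderiv I 𝓘(ℝ, E) (extChartAt I x) x u)) (mfderiv I 𝓘(ℝ, E) (extChartAt I x) x v)
    - (fderivWithin ℝ (oneFormInChart I (fun y => (e₁ y).2) x) (range I) (extChartAt I x x)
      (mfderiv I 𝓘(ℝ, E) (extChartAt I x) x v)) (mfderiv I 𝓘(ℝ, E) (extChartAt I x) x u) = _
  rw [hD, mfderiv_extChartAt_self]
  rfl

omit [I.Boundaryless] in
theorem hasFDerivAt_pairing (h₁ : DiffAt I e₁ x) (h₂ : DiffAt I e₂ x) :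
    HasFDerivAt (fun z => (localRep I x e₂ z).2 (localRep I x e₁ z).1)
    ((e₂ x).2.comp ((ContinuousLinearMap.fst ℝ E (E →L[ℝ] ℝ)).comp (jet I e₁ x)) +
     ((ContinuousLinearMap.snd ℝ E (E →L[ℝ] ℝ)).comp (jet I e₂ x)).flip (e₁ x).1)
    (extChartAt I x x) := by
  have := h₂.snd.clm_apply h₁.fst
  rw [localRep_self, localRep_self] at this
  exact this

theorem differential_pairing (h₁ : DiffAt I e₁ x) (h₂ : DiffAt I e₂ x) (v : E) :
    differential I (fun y => (e₂ y).2 (e₁ y).1) x v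
      = (e₂ x).2 (jet I e₁ x v).1 + (jet I e₂ x v).2 (e₁ x).1 := by
  have := hasFDerivAt_pairing I h₁ h₂
  rw [differential_eq_fderiv I this.differentiableAt (pairing_eventuallyEq I e₁ e₂ x), this.fderiv]
  rfl

theorem differential_pairing_sub (h₁ : DiffAt I e₁ x) (h₂ : DiffAt I e₂ x) (v : E) :
    differential I (fun y => (e₂ y).2 (e₁ y).1 - (e₁ y).2 (e₂ y).1) x v
      = ((e₂ x).2 (jet I e₁ x v).1 + (jet I e₂ x v).2 (e₁ x).1)
      - ((e₁ x).2 (jet I e₂ x v).1 + (jet I e₁ x v).2 (e₂ x).1) := by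
  have := (hasFDerivAt_pairing I h₁ h₂).sub (hasFDerivAt_pairing I h₂ h₁)
  rw [differential_eq_fderiv I (f := fun y => (e₂ y).2 (e₁ y).1 - (e₁ y).2 (e₂ y).1)
    this.differentiableAt
    ((pairing_eventuallyEq I e₁ e₂ x).sub (pairing_eventuallyEq I e₂ e₁ x)), this.fderiv]
  rfl

/-- By Cartan's formula the 1-form component is a sum of first derivatives. The terms of `dα`, `dβ`
and of the differentials of the pairings recombine into derivatives along the anchors plus
half-pairings, that is, into the metric term of `jetBracket`. -/
theorem courant_eq_modelBracket (h₁ : DiffAt I e₁ x) (h₂ : DiffAt I e₂ x) :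
    courant I e₁ e₂ x = modelBracket (E := E) (e₁ x) (jet I e₁ x) (e₂ x) (jet I e₂ x) := by
  refine Prod.ext ?_ ?_
  · refine (mlieBracket_eq_jet I h₁ h₂).trans ?_
    exact (add_zero _).symm
  · refine ContinuousLinearMap.ext fun (v : E) => ?_
    -- The five summands are replaced through `key` so that they are matched up to the definitional
    -- equality of the tangent space with `E`.
    have key {p q r s t p' q' r' s' t' c : ℝ} (hp : p = p') (hq : q = q') (hr : r = r')
        (hs : s = s') (ht : t = t') (h : p' + q' - (r' + s') - 1 / 2 * t' = c) :
        p + q - (r + s) - 1 / 2 * t = c := by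
      rw [hp, hq, hr, hs, ht, h]
    refine key (extD_eq_jet I h₂ _ v) (differential_pairing I h₁ h₂ v) (extD_eq_jet I h₁ _ v)
      (differential_pairing I h₂ h₁ v) (differential_pairing_sub I h₁ h₂ v) ?_
    change _ = ((jet I e₂ x (e₁ x).1).2 v - (jet I e₁ x (e₂ x).1).2 v)
        + (1 / 2 * ((e₂ x).2 (jet I e₁ x v).1 + (jet I e₁ x v).2 (e₂ x).1)
          - 1 / 2 * ((e₁ x).2 (jet I e₂ x v).1 + (jet I e₂ x v).2 (e₁ x).1))
    ring

end CourantInChart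

/-! ### Bundle endomorphisms in a chart, and global extension of vectors. -/

section Endomorphisms

variable {E : Type*} [NormedAddCommGroup E] [NormedSpace ℝ E]
  {H : Type*} [TopologicalSpace H] (I : ModelWithCorners ℝ E H)
  {M : Type*} [TopologicalSpace M] [ChartedSpace H M] [IsManifold I ∞ M]

/-- `Â` is a differentiable representation, in the preferred chart at `x`, of the endomorphism `A`
of the big tangent bundle. -/
structure HasEndoRepAt (A : ∀ x : M, BigTangent I x →L[ℝ] BigTangent I x) (x : M)
    (Â : E → (E × (E →L[ℝ] ℝ)) →L[ℝ] (E × (E →L[ℝ] ℝ))) : Prop where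
  differentiableAt : DifferentiableAt ℝ Â (extChartAt I x x)
  eventually_apply : ∀ᶠ z in 𝓝 (extChartAt I x x), ∀ v : BigTangent I ((extChartAt I x).symm z),
    readFibre I x ((extChartAt I x).symm z) (A _ v)
      = Â z (readFibre I x ((extChartAt I x).symm z) v)

variable {I} {A : ∀ x : M, BigTangent I x →L[ℝ] BigTangent I x} {x : M}
  {Â : E → (E × (E →L[ℝ] ℝ)) →L[ℝ] (E × (E →L[ℝ] ℝ))} {e e₁ e₂ : ∀ x : M, BigTangent I x}

theorem HasEndoRepAt.apply_self (h : HasEndoRepAt I A x Â) (v : BigTangent I x) :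
    Â (extChartAt I x x) v = A x v := by
  have := h.eventually_apply.self_of_nhds
  rw [extChartAt_to_inv] at this
  simpa only [readFibre_self] using (this v).symm

theorem HasEndoRepAt.localRep_eventuallyEq (h : HasEndoRepAt I A x Â)
    (e : ∀ x : M, BigTangent I x) :
    localRep I x (applyEndo I A e) =ᶠ[𝓝 (extChartAt I x x)] fun z => Â z (localRep I x e z) := by
  filter_upwards [h.eventually_apply] with z hz using hz _

theorem HasEndoRepAt.hasFDerivAt (h : HasEndoRepAt I A x Â) (he : DiffAt I e x) :
    HasFDerivAt (localRep I x (applyEndo I A e))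
      ((Â (extChartAt I x x)).comp (jet I e x)
        + (fderiv ℝ Â (extChartAt I x x)).flip (localRep I x e (extChartAt I x x)))
      (extChartAt I x x) :=
  (h.differentiableAt.hasFDerivAt.clm_apply he.hasFDerivAt).congr_of_eventuallyEq
    (h.localRep_eventuallyEq e)

theorem HasEndoRepAt.diffAt (h : HasEndoRepAt I A x Â) (he : DiffAt I e x) :
    DiffAt I (applyEndo I A e) x :=
  (h.hasFDerivAt he).differentiableAt

theorem HasEndoRepAt.jet_applyEndo (h : HasEndoRepAt I A x Â) (he : DiffAt I e x) :
    jet I (applyEndo I A e) x = (Â (extChartAt I x x)).comp (jet I e x)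
        + (fderiv ℝ Â (extChartAt I x x)).flip (localRep I x e (extChartAt I x x)) :=
  (h.hasFDerivAt he).fderiv

variable (I) in
/-- The expression `⟦J e₁, J e₂⟧ - J (⟦J e₁, e₂⟧ + ⟦e₁, J e₂⟧) + ⟦e₁, e₂⟧`. -/
def torsion (J : ∀ x : M, BigTangent I x →L[ℝ] BigTangent I x) (e₁ e₂ : ∀ x : M, BigTangent I x)
    (x : M) : BigTangent I x :=
  courant I (applyEndo I J e₁) (applyEndo I J e₂) x
      - J x (courant I (applyEndo I J e₁) e₂ x + courant I e₁ (applyEndo I J e₂) x)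
      + courant I e₁ e₂ x

theorem HasEndoRepAt.torsion_eq [I.Boundaryless] (h : HasEndoRepAt I A x Â) (h₁ : DiffAt I e₁ x)
    (h₂ : DiffAt I e₂ x) :
    torsion I A e₁ e₂ x =
      jetTorsion (ContinuousLinearMap.fst ℝ E (E →L[ℝ] ℝ)) (ContinuousLinearMap.inr ℝ E (E →L[ℝ] ℝ))
        (modelFlat E) (Â (extChartAt I x x)) (fderiv ℝ Â (extChartAt I x x))
        (e₁ x) (jet I e₁ x) (e₂ x) (jet I e₂ x) := by
  have j₁ := h.jet_applyEndo h₁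
  have j₂ := h.jet_applyEndo h₂
  rw [localRep_self] at j₁ j₂
  rw [torsion, courant_eq_modelBracket I (h.diffAt h₁) (h.diffAt h₂),
    courant_eq_modelBracket I (h.diffAt h₁) h₂, courant_eq_modelBracket I h₁ (h.diffAt h₂),
    courant_eq_modelBracket I h₁ h₂, j₁, j₂, ← h.apply_self]
  simp only [applyEndo, ← h.apply_self]
  rfl

theorem IsSmoothEndo.smoothSection (hA : IsSmoothEndo I A) (he : IsSmoothSection I e) :
    IsSmoothSection I (applyEndo I A e) :=
  fun x => ContMDiffAt.clm_bundle_apply (hA x) (he x)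

theorem continuousLinearMapAt_eq_readFibre {x₀ y : M} (hy : y ∈ (chartAt H x₀).source)
    (v : BigTangent I y) :
    (trivializationAt (E × (E →L[ℝ] ℝ))
      (fun y : M => BigTangent I y) x₀).continuousLinearMapAt ℝ y v
      = readFibre I x₀ y v := by
  have hb : y ∈ (trivializationAt (E × (E →L[ℝ] ℝ)) (fun y : M => BigTangent I y) x₀).baseSet :=
    ⟨hy, hy, mem_univ _⟩
  rw [Bundle.Trivialization.continuousLinearMapAt_apply,
    Bundle.Trivialization.coe_linearMapAt_of_mem _ hb]
  exact trivializationAt_eq_readFibre I hy v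

set_option synthInstance.maxHeartbeats 400000 in
theorem IsSmoothEndo.hasEndoRepAt [I.Boundaryless] (hA : IsSmoothEndo I A) (x : M) :
    ∃ Â, HasEndoRepAt I A x Â := by
  have h := (contMDiffAt_hom_bundle _).1 (hA x)
  refine ⟨_, ContMDiffAt.differentiableAt_comp_extChartAt_symm I h.2, ?_⟩
  filter_upwards [extChartAt_symm_mem_source I x] with z hz v
  have hb : (extChartAt I x).symm z
      ∈ (trivializationAt (E × (E →L[ℝ] ℝ)) (fun y : M => BigTangent I y) x).baseSet :=
    ⟨hz, hz, mem_univ _⟩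
  rw [← continuousLinearMapAt_eq_readFibre hz, ← continuousLinearMapAt_eq_readFibre hz]
  simp only [Function.comp_apply, ContinuousLinearMap.inCoordinates,
    ContinuousLinearMap.comp_apply]
  rw [Bundle.Trivialization.symmL_continuousLinearMapAt _ hb]

/-- A partition of unity glues local sections with values in convex sets: here `{v}` over `x` and
the whole fibre elsewhere. Near `x` a local extension of `v` is used; away from `x`, the zero
section on the open set `{x}ᶜ`. -/
theorem exists_smoothSection [FiniteDimensional ℝ E] [T2Space M] [SigmaCompactSpace M] (x : M)
    (v : BigTangent I x) : ∃ e : ∀ y : M, BigTangent I y, IsSmoothSection I e ∧ e x = v := by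
  classical
  let t : ∀ y : M, Set (BigTangent I y) := fun y => {w | ∀ h : y = x, w = h ▸ v}
  have hconv (y : M) : Convex ℝ (t y) := by
    by_cases h : y = x
    · subst h
      simp [t]
    · simpa [t, h] using convex_univ
  have hloc (y : M) : ∃ U ∈ 𝓝 y, ∃ s : ∀ z : M, BigTangent I z,
      ContMDiffOn I (I.prod 𝓘(ℝ, E × (E →L[ℝ] ℝ))) ∞ (fun z => Bundle.TotalSpace.mk'
        (E × (E →L[ℝ] ℝ)) (E := fun y : M => BigTangent I y) z (s z)) U ∧ ∀ z ∈ U, s z ∈ t z := by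
    by_cases h : y = x
    · subst h
      obtain ⟨U, hU, hsU⟩ := FiberBundle.exists_contMDiffOn_extend (k := ∞) I
        (E × (E →L[ℝ] ℝ)) (V := fun y : M => BigTangent I y) v
      refine ⟨U, hU, _, hsU, ?_⟩
      rintro z - rfl
      exact FiberBundle.extend_apply_self _ _
    · refine ⟨{x}ᶜ, isOpen_compl_singleton.mem_nhds h, fun _ => 0, ?_, ?_⟩
      · exact (Bundle.contMDiff_zeroSection ℝ (fun y : M => BigTangent I y)).contMDiffOn
      · intro z hz hzx
        exact absurd hzx hz
  obtain ⟨s, hs⟩ := exists_contMDiffSection_forall_mem_convex_of_local (n := ⊤) I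
    (F_fiber := E × (E →L[ℝ] ℝ)) (fun y : M => BigTangent I y) t hconv hloc
  exact ⟨s, s.contMDiff, hs x rfl⟩

end Endomorphisms

/-! ### The structure `J` and the bracket over `E × ℝ`. -/

section ProductModel

variable {E : Type*} [NormedAddCommGroup E] [NormedSpace ℝ E]

/-- The inclusion `(X, α) ↦ (X + 0 ∂_t, α + 0 dt)` for a normed space. -/
def modelIncl (E : Type*) [NormedAddCommGroup E] [NormedSpace ℝ E] :
    E × (E →L[ℝ] ℝ) →L[ℝ] (E × ℝ) × (E × ℝ →L[ℝ] ℝ) :=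
  ContinuousLinearMap.prodMap (ContinuousLinearMap.inl ℝ E ℝ)
    ((ContinuousLinearMap.fst ℝ E ℝ).precomp ℝ)

/-- The projection `(X + f ∂_t, α + g dt) ↦ (X, α)` for a normed space. -/
def modelProj (E : Type*) [NormedAddCommGroup E] [NormedSpace ℝ E] :
    (E × ℝ) × (E × ℝ →L[ℝ] ℝ) →L[ℝ] E × (E →L[ℝ] ℝ) :=
  ContinuousLinearMap.prodMap (ContinuousLinearMap.fst ℝ E ℝ)
    ((ContinuousLinearMap.inl ℝ E ℝ).precomp ℝ)

/-- The endomorphism of `(E × ℝ) × (E × ℝ)*` attached to an endomorphism `A` and to an element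
`b = (Z, ξ)` of `E × E*`. -/
def modelProductEndo (A : E × (E →L[ℝ] ℝ) →L[ℝ] E × (E →L[ℝ] ℝ)) (b : E × (E →L[ℝ] ℝ)) :
    (E × ℝ) × (E × ℝ →L[ℝ] ℝ) →L[ℝ] (E × ℝ) × (E × ℝ →L[ℝ] ℝ) :=
  (modelIncl E).comp (A.comp (modelProj E))
    + ((ContinuousLinearMap.apply ℝ ℝ ((0, 1) : E × ℝ)).comp
        (ContinuousLinearMap.snd ℝ (E × ℝ) ((E × ℝ) →L[ℝ] ℝ))).smulRight (modelIncl E (b.1, 0))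
    - ((ContinuousLinearMap.snd ℝ E ℝ).comp
        (ContinuousLinearMap.fst ℝ (E × ℝ) ((E × ℝ) →L[ℝ] ℝ))).smulRight (modelIncl E (0, b.2))
    - (((ContinuousLinearMap.apply ℝ ℝ b.1).comp
        ((ContinuousLinearMap.snd ℝ _ _).comp (modelProj E))).smulRight (((0, 1) : E × ℝ), 0))
    + ((b.2.comp ((ContinuousLinearMap.fst ℝ _ _).comp (modelProj E))).smulRight
        (0, ContinuousLinearMap.snd ℝ E ℝ))

theorem modelProductEndo_apply (A : E × (E →L[ℝ] ℝ) →L[ℝ] E × (E →L[ℝ] ℝ)) (b : E × (E →L[ℝ] ℝ))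
    (v : (E × ℝ) × (E × ℝ →L[ℝ] ℝ)) :
    modelProductEndo A b v = modelIncl E (A (modelProj E v)) + v.2 (0, 1) • modelIncl E (b.1, 0)
      - v.1.2 • modelIncl E (0, b.2) - (modelProj E v).2 b.1 • (((0, 1) : E × ℝ), 0)
      + b.2 (modelProj E v).1 • (0, ContinuousLinearMap.snd ℝ E ℝ) := rfl

theorem _root_.DifferentiableAt.clm_smulRight {X U W : Type*} [NormedAddCommGroup X]
    [NormedSpace ℝ X]
    [NormedAddCommGroup U] [NormedSpace ℝ U] [NormedAddCommGroup W] [NormedSpace ℝ W]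
    {c : X → U →L[ℝ] ℝ} {f : X → W} {x : X} (hc : DifferentiableAt ℝ c x)
    (hf : DifferentiableAt ℝ f x) : DifferentiableAt ℝ (fun y => (c y).smulRight (f y)) x :=
  DifferentiableAt.comp (g := fun q : (U →L[ℝ] ℝ) × W => q.1.smulRight q.2) x
    (isBoundedBilinearMap_smulRight.differentiableAt (c x, f x)) (hc.prodMk hf)

/-- The shape of `modelProductEndo`, with abstract spaces in place of the dual spaces: only
continuous linearity of the building blocks in `A` and `b` matters. -/
theorem differentiableAt_endo_of_components {X Y E G W : Type*} [NormedAddCommGroup X]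
    [NormedSpace ℝ X] [NormedAddCommGroup Y] [NormedSpace ℝ Y] [NormedAddCommGroup E]
    [NormedSpace ℝ E] [NormedAddCommGroup G] [NormedSpace ℝ G] [NormedAddCommGroup W]
    [NormedSpace ℝ W] {A : X → E × G →L[ℝ] E × G} {b : X → E × G} {z : X × Y}
    (hA : DifferentiableAt ℝ A z.1) (hb : DifferentiableAt ℝ b z.1)
    (i : E × G →L[ℝ] W) (p : W →L[ℝ] E × G) (c c' : W →L[ℝ] ℝ) (m : E →L[ℝ] G →L[ℝ] ℝ)
    (n : G →L[ℝ] E →L[ℝ] ℝ) (u u' : W) :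
    DifferentiableAt ℝ (fun y : X × Y => i.comp ((A y.1).comp p) + c.smulRight (i ((b y.1).1, 0))
      - c'.smulRight (i (0, (b y.1).2))
      - ((m (b y.1).1).comp ((ContinuousLinearMap.snd ℝ E G).comp p)).smulRight u
      + ((n (b y.1).2).comp ((ContinuousLinearMap.fst ℝ E G).comp p)).smulRight u') z := by
  have hA' : DifferentiableAt ℝ (fun y : X × Y => A y.1) z := hA.comp z differentiableAt_fst
  have hb' : DifferentiableAt ℝ (fun y : X × Y => b y.1) z := hb.comp z differentiableAt_fst
  refine ((((?_ : DifferentiableAt ℝ _ z).add ?_).sub ?_).sub ?_).add ?_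
  · exact (differentiableAt_const _).clm_comp (hA'.clm_comp (differentiableAt_const _))
  · exact (differentiableAt_const _).clm_smulRight
      (i.differentiableAt.comp z (hb'.fst.prodMk (differentiableAt_const _)))
  · exact (differentiableAt_const _).clm_smulRight
      (i.differentiableAt.comp z ((differentiableAt_const _).prodMk hb'.snd))
  · exact ((m.differentiableAt.comp z hb'.fst).clm_comp (differentiableAt_const _)).clm_smulRight
      (differentiableAt_const _)
  · exact ((n.differentiableAt.comp z hb'.snd).clm_comp (differentiableAt_const _)).clm_smulRight
      (differentiableAt_const _)

set_option synthInstance.maxHeartbeats 400000 in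
theorem differentiableAt_modelProductEndo {A : E → E × (E →L[ℝ] ℝ) →L[ℝ] E × (E →L[ℝ] ℝ)}
    {b : E → E × (E →L[ℝ] ℝ)} {z : E × ℝ} (hA : DifferentiableAt ℝ A z.1)
    (hb : DifferentiableAt ℝ b z.1) :
    DifferentiableAt ℝ (fun w : E × ℝ => modelProductEndo (A w.1) (b w.1)) z :=
  differentiableAt_endo_of_components hA hb (modelIncl E) (modelProj E) _ _
    (ContinuousLinearMap.apply ℝ ℝ) (ContinuousLinearMap.id ℝ (E →L[ℝ] ℝ)) _ _

/-- Bracket of translation-invariant sections without `∂_t` and `dt` components. -/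
theorem modelBracket_incl (a b : E × (E →L[ℝ] ℝ)) (L K : E →L[ℝ] E × (E →L[ℝ] ℝ)) :
    modelBracket (modelIncl E a) ((modelIncl E).comp (L.comp (ContinuousLinearMap.fst ℝ E ℝ)))
      (modelIncl E b) ((modelIncl E).comp (K.comp (ContinuousLinearMap.fst ℝ E ℝ)))
      = modelIncl E (modelBracket a L b K) := by
  simp only [modelBracket, jetBracket, map_add, map_sub]
  rfl

/-- Bracket of a translation-invariant section without `∂_t` and `dt` components with a constant
combination of `∂_t` and `dt`. -/
theorem modelBracket_incl_const (a : E × (E →L[ℝ] ℝ)) (L : E →L[ℝ] E × (E →L[ℝ] ℝ)) (c d : ℝ) :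
    modelBracket (modelIncl E a) ((modelIncl E).comp (L.comp (ContinuousLinearMap.fst ℝ E ℝ)))
      ((0, c), d • ContinuousLinearMap.snd ℝ E ℝ) 0 = 0 := by
  -- `∂_t` and `dt` are orthogonal to the included copy of `E × E*`, so the metric term vanishes.
  -- The derivative along `∂_t` vanishes since the section does not depend on `t`.
  have h : (modelFlat (E × ℝ) ((0, c), d • ContinuousLinearMap.snd ℝ E ℝ)).comp
      ((modelIncl E).comp (L.comp (ContinuousLinearMap.fst ℝ E ℝ))) = 0 := by
    refine ContinuousLinearMap.ext fun v => ?_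
    change 1 / 2 * (d * (0 : ℝ) + (L v.1).2 0) = 0
    simp
  simp only [modelBracket, jetBracket]
  rw [h]
  simp

end ProductModel

/-! ### Charts of `M × ℝ` and the representative of `J`. -/

section ProductManifold

variable {E : Type*} [NormedAddCommGroup E] [NormedSpace ℝ E]
  {H : Type*} [TopologicalSpace H] (I : ModelWithCorners ℝ E H)
  {M : Type*} [TopologicalSpace M] [ChartedSpace H M] [IsManifold I ∞ M] [I.Boundaryless]

/-- The transition map of `M × ℝ` is the transition map of `M` times the identity of `ℝ`; uniqueness
of the derivative gives the equality. -/
theorem tangentCoordChange_prod {p q r : M × ℝ} (hp : r.1 ∈ (chartAt H p.1).source)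
    (hq : r.1 ∈ (chartAt H q.1).source) :
    tangentCoordChange (I.prod 𝓘(ℝ, ℝ)) p q r
      = (tangentCoordChange I p.1 q.1 r.1).prodMap (ContinuousLinearMap.id ℝ ℝ) := by
  have hr : range (I.prod 𝓘(ℝ, ℝ)) = univ := ModelWithCorners.range_eq_univ _
  have h1 : HasFDerivWithinAt _ _ _ _ :=
    hasFDerivWithinAt_tangentCoordChange (I := I.prod 𝓘(ℝ, ℝ)) (x := p) (y := q) (z := r)
      (by simpa [hp, hq] using ⟨mem_univ _, mem_univ _⟩)
  have h2 := hasFDerivWithinAt_tangentCoordChange (I := I) (x := p.1) (y := q.1) (z := r.1)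
      (by simp [hp, hq])
  rw [hr, hasFDerivWithinAt_univ] at h1
  rw [I.range_eq_univ, hasFDerivWithinAt_univ] at h2
  refine h1.unique ?_
  have h3 := HasFDerivAt.prodMap (extChartAt (I.prod 𝓘(ℝ, ℝ)) p r) h2 (hasFDerivAt_id (𝕜 := ℝ) r.2)
  exact h3

theorem continuousLinearMapAt_prod {p q : M × ℝ} (hq : q.1 ∈ (chartAt H p.1).source) :
    (trivializationAt (E × ℝ) (TangentSpace (I.prod 𝓘(ℝ, ℝ))) p).continuousLinearMapAt ℝ q
      = ((trivializationAt E (TangentSpace I) p.1).continuousLinearMapAt ℝ q.1 : E →L[ℝ] E).prodMap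
        (ContinuousLinearMap.id ℝ ℝ) := by
  have hq' : q ∈ (chartAt (ModelProd H ℝ) p).source := by
    rw [prodChartedSpace_chartAt]
    exact ⟨hq, mem_univ _⟩
  rw [TangentBundle.continuousLinearMapAt_trivializationAt_eq_core hq',
    TangentBundle.continuousLinearMapAt_trivializationAt_eq_core hq]
  exact tangentCoordChange_prod I (mem_chart_source H q.1) hq

theorem symmL_prod {p q : M × ℝ} (hq : q.1 ∈ (chartAt H p.1).source) :
    (trivializationAt (E × ℝ) (TangentSpace (I.prod 𝓘(ℝ, ℝ))) p).symmL ℝ q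
      = ((trivializationAt E (TangentSpace I) p.1).symmL ℝ q.1 : E →L[ℝ] E).prodMap
        (ContinuousLinearMap.id ℝ ℝ) := by
  have hq' : q ∈ (chartAt (ModelProd H ℝ) p).source := by
    rw [prodChartedSpace_chartAt]
    exact ⟨hq, mem_univ _⟩
  rw [TangentBundle.symmL_trivializationAt_eq_core hq',
    TangentBundle.symmL_trivializationAt_eq_core hq]
  exact tangentCoordChange_prod I hq (mem_chart_source H q.1)

theorem readFibre_prod {p q : M × ℝ} (hq : q.1 ∈ (chartAt H p.1).source)
    (v : (E × ℝ) × (E × ℝ →L[ℝ] ℝ)) :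
    readFibre (I.prod 𝓘(ℝ, ℝ)) p q v
      = (((trivializationAt E (TangentSpace I) p.1).continuousLinearMapAt ℝ q.1 v.1.1, v.1.2),
        v.2.comp (((trivializationAt E (TangentSpace I) p.1).symmL ℝ q.1 : E →L[ℝ] E).prodMap
          (ContinuousLinearMap.id ℝ ℝ))) := by
  have h1 := continuousLinearMapAt_prod I hq
  have h2 := symmL_prod I hq
  exact Prod.ext (congrArg (fun A : E × ℝ →L[ℝ] E × ℝ => A v.1) h1)
    (congrArg (fun A : E × ℝ →L[ℝ] E × ℝ => v.2.comp A) h2)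

theorem readFibre_incl {p q : M × ℝ} (hq : q.1 ∈ (chartAt H p.1).source)
    (v : BigTangent I q.1) :
    readFibre (I.prod 𝓘(ℝ, ℝ)) p q (inclBig I q v) = modelIncl E (readFibre I p.1 q.1 v) :=
  readFibre_prod I hq _

theorem readFibre_const {p q : M × ℝ} (hq : q.1 ∈ (chartAt H p.1).source) (c d : ℝ) :
    readFibre (I.prod 𝓘(ℝ, ℝ)) p q (((0, c) : E × ℝ), d • ContinuousLinearMap.snd ℝ E ℝ)
      = (((0, c) : E × ℝ), d • ContinuousLinearMap.snd ℝ E ℝ) := by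
  refine (readFibre_prod I hq _).trans (Prod.ext (Prod.ext ?_ rfl) rfl)
  exact map_zero ((trivializationAt E (TangentSpace I) p.1).continuousLinearMapAt ℝ q.1)

omit [I.Boundaryless] in
theorem readFibre_add (x y : M) (v w : BigTangent I y) :
    readFibre I x y (v + w) = readFibre I x y v + readFibre I x y w :=
  Prod.ext (map_add ((trivializationAt E (TangentSpace I) x).continuousLinearMapAt ℝ y) v.1 w.1)
    rfl

omit [I.Boundaryless] in
theorem readFibre_smul (x y : M) (c : ℝ) (v : BigTangent I y) :
    readFibre I x y (c • v) = c • readFibre I x y v :=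
  Prod.ext (map_smul ((trivializationAt E (TangentSpace I) x).continuousLinearMapAt ℝ y) c v.1)
    rfl

omit [I.Boundaryless] in
theorem readFibre_sub (x y : M) (v w : BigTangent I y) :
    readFibre I x y (v - w) = readFibre I x y v - readFibre I x y w :=
  Prod.ext (map_sub ((trivializationAt E (TangentSpace I) x).continuousLinearMapAt ℝ y) v.1 w.1)
    rfl

omit [I.Boundaryless] in
theorem readFibre_pairing {x y : M} (hy : y ∈ (chartAt H x).source) (v w : BigTangent I y) :
    (readFibre I x y v).2 (readFibre I x y w).1 = v.2 w.1 := by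
  simp only [readFibre, ContinuousLinearMap.comp_apply]
  rw [Bundle.Trivialization.symmL_continuousLinearMapAt _ (by simpa using hy)]

omit [IsManifold I ∞ M] [I.Boundaryless] in
theorem productEndo_apply (F : ∀ x : M, BigTangent I x →L[ℝ] BigTangent I x)
    (Z : ∀ x : M, TangentSpace I x) (ξ : ∀ x : M, CotangentSpace I x) (q : M × ℝ)
    (v : BigTangent (I.prod 𝓘(ℝ, ℝ)) q) :
    productEndo I F Z ξ q v = inclBig I q (F q.1 (projBig I q v))
      + coeffDt I q v • inclBig I q (Z q.1, 0) - coeffDdt I q v • inclBig I q (0, ξ q.1)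
      - (projBig I q v).2 (Z q.1) • bigDdt I q + ξ q.1 (projBig I q v).1 • bigDt I q := rfl

theorem readFibre_bigDdt {p q : M × ℝ} (hq : q.1 ∈ (chartAt H p.1).source) :
    readFibre (I.prod 𝓘(ℝ, ℝ)) p q (bigDdt I q) = (((0, 1) : E × ℝ), 0) := by
  have h := readFibre_const I hq 1 0
  rw [zero_smul] at h
  exact h

theorem readFibre_bigDt {p q : M × ℝ} (hq : q.1 ∈ (chartAt H p.1).source) :
    readFibre (I.prod 𝓘(ℝ, ℝ)) p q (bigDt I q) = (0, ContinuousLinearMap.snd ℝ E ℝ) := by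
  have h := readFibre_const I hq 0 1
  rw [one_smul] at h
  exact h

/-- Product charts fix `∂_t` and `dt`, commute with the inclusion and the projection, and preserve
the pairings `α(Z)` and `ξ(X)`; so every term of `J` is read as the corresponding term of the model.
-/
theorem readFibre_productEndo (F : ∀ x : M, BigTangent I x →L[ℝ] BigTangent I x)
    (Z : ∀ x : M, TangentSpace I x) (ξ : ∀ x : M, CotangentSpace I x) {p q : M × ℝ}
    (hq : q.1 ∈ (chartAt H p.1).source) {A : E × (E →L[ℝ] ℝ) →L[ℝ] E × (E →L[ℝ] ℝ)}
    (hA : ∀ v, readFibre I p.1 q.1 (F q.1 v) = A (readFibre I p.1 q.1 v))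
    (v : BigTangent (I.prod 𝓘(ℝ, ℝ)) q) :
    readFibre (I.prod 𝓘(ℝ, ℝ)) p q (productEndo I F Z ξ q v)
      = modelProductEndo A (readFibre I p.1 q.1 (Z q.1, ξ q.1))
        (readFibre (I.prod 𝓘(ℝ, ℝ)) p q v) := by
  have hproj : modelProj E (readFibre (I.prod 𝓘(ℝ, ℝ)) p q v)
      = readFibre I p.1 q.1 (projBig I q v) := by
    rw [show readFibre (I.prod 𝓘(ℝ, ℝ)) p q v = _ from readFibre_prod I hq v]
    refine Prod.ext rfl (ContinuousLinearMap.ext fun w => ?_)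
    rfl
  have hdt : (readFibre (I.prod 𝓘(ℝ, ℝ)) p q v).2 ((0, 1) : E × ℝ) = coeffDt I q v := by
    rw [show readFibre (I.prod 𝓘(ℝ, ℝ)) p q v = _ from readFibre_prod I hq v]
    refine congrArg v.2 (Prod.ext ?_ rfl)
    exact map_zero ((trivializationAt E (TangentSpace I) p.1).symmL ℝ q.1)
  have hddt : (readFibre (I.prod 𝓘(ℝ, ℝ)) p q v).1.2 = coeffDdt I q v := by
    rw [show readFibre (I.prod 𝓘(ℝ, ℝ)) p q v = _ from readFibre_prod I hq v]
    rfl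
  have hZ : (((readFibre I p.1 q.1 (Z q.1, ξ q.1)).1, 0) : E × (E →L[ℝ] ℝ))
      = readFibre I p.1 q.1 (Z q.1, 0) := rfl
  have hξ : ((0, (readFibre I p.1 q.1 (Z q.1, ξ q.1)).2) : E × (E →L[ℝ] ℝ))
      = readFibre I p.1 q.1 (0, ξ q.1) :=
    Prod.ext (map_zero ((trivializationAt E (TangentSpace I) p.1).continuousLinearMapAt ℝ q.1)).symm
      rfl
  rw [modelProductEndo_apply, hproj, hdt, hddt, hZ, hξ, readFibre_pairing I hq,
    readFibre_pairing I hq, ← hA, productEndo_apply, readFibre_add, readFibre_sub, readFibre_sub,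
    readFibre_add, readFibre_smul, readFibre_smul, readFibre_smul, readFibre_smul,
    readFibre_incl I hq, readFibre_incl I hq, readFibre_incl I hq, readFibre_bigDdt I hq,
    readFibre_bigDt I hq]

variable {I}

set_option synthInstance.maxHeartbeats 400000 in
theorem HasEndoRepAt.productEndo {F : ∀ x : M, BigTangent I x →L[ℝ] BigTangent I x}
    {Z : ∀ x : M, TangentSpace I x} {ξ : ∀ x : M, CotangentSpace I x} {p : M × ℝ}
    {F' : E → E × (E →L[ℝ] ℝ) →L[ℝ] E × (E →L[ℝ] ℝ)} (hF : HasEndoRepAt I F p.1 F')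
    (hZ : DiffAt I (fun x => (Z x, ξ x)) p.1) :
    HasEndoRepAt (I.prod 𝓘(ℝ, ℝ)) (productEndo I F Z ξ) p
      fun z => modelProductEndo (F' z.1) (localRep I p.1 (fun x => (Z x, ξ x)) z.1) := by
  have hfst : Tendsto Prod.fst (𝓝 (extChartAt (I.prod 𝓘(ℝ, ℝ)) p p)) (𝓝 (extChartAt I p.1 p.1)) :=
    (continuous_fst (X := E) (Y := ℝ)).tendsto _
  refine ⟨?_, ?_⟩
  · exact differentiableAt_modelProductEndo (z := extChartAt (I.prod 𝓘(ℝ, ℝ)) p p)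
      hF.differentiableAt hZ
  · filter_upwards [hfst.eventually (extChartAt_symm_mem_source I p.1),
      hfst.eventually hF.eventually_apply] with z hz hA v
    exact readFibre_productEndo I F Z ξ (q := (extChartAt (I.prod 𝓘(ℝ, ℝ)) p).symm z) hz hA v

end ProductManifold

/-! ### The torsion of a skew involution is a tensor. -/

section TorsionTensor

variable {E : Type*} [NormedAddCommGroup E] [NormedSpace ℝ E]
  {H : Type*} [TopologicalSpace H] {I : ModelWithCorners ℝ E H}
  {M : Type*} [TopologicalSpace M] [ChartedSpace H M] [IsManifold I ∞ M] [I.Boundaryless]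

theorem courant_swap {e₁ e₂ : ∀ x : M, BigTangent I x} {x : M} (h₁ : DiffAt I e₁ x)
    (h₂ : DiffAt I e₂ x) : courant I e₁ e₂ x = -courant I e₂ e₁ x := by
  rw [courant_eq_modelBracket I h₁ h₂, courant_eq_modelBracket I h₂ h₁]
  exact jetBracket_swap (E := E) (V := E × (E →L[ℝ] ℝ)) _ _ _ _ _ _ _

theorem involution_identity {V : Type*} [AddCommGroup V] [Module ℝ V] [TopologicalSpace V]
    (J : V →L[ℝ] V) (hJ : ∀ a, J (J a) = a) (p q r s : V) :
    p - J (q + r) + s = -J (r - J (s + p) + q) := by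
  simp only [map_add, map_sub, hJ]
  abel

omit [IsManifold I ∞ M] [I.Boundaryless] in
-- Since `J² = I`, replacing `e₁` by `J e₁` only permutes the four brackets of the torsion.
theorem torsion_applyEndo_left {J : ∀ x : M, BigTangent I x →L[ℝ] BigTangent I x}
    (hsq : ∀ x a, J x (J x a) = a) (e₁ e₂ : ∀ x : M, BigTangent I x) (x : M) :
    torsion I J (applyEndo I J e₁) e₂ x = -J x (torsion I J e₁ e₂ x) := by
  have h : applyEndo I J (applyEndo I J e₁) = e₁ := funext fun y => hsq y _
  rw [torsion, torsion, h]
  exact involution_identity (J x) (hsq x) _ _ _ _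

/-- For a skew-adjoint involution `J`, the Nijenhuis torsion of `J` is a tensor. -/
theorem exists_torsionTensor [FiniteDimensional ℝ E] [T2Space M] [SigmaCompactSpace M]
    {J : ∀ x : M, BigTangent I x →L[ℝ] BigTangent I x} (hsq : ∀ x a, J x (J x a) = a) {x : M}
    (hskew : ∀ a b : BigTangent I x, metric I (J x a) b + metric I a (J x b) = 0)
    {J' : E → E × (E →L[ℝ] ℝ) →L[ℝ] E × (E →L[ℝ] ℝ)} (hJ : HasEndoRepAt I J x J') :
    ∃ T : BigTangent I x →ₗ[ℝ] BigTangent I x →ₗ[ℝ] BigTangent I x,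
      (∀ e₁ e₂, DiffAt I e₁ x → DiffAt I e₂ x → torsion I J e₁ e₂ x = T (e₁ x) (e₂ x)) ∧
      (∀ a b, T a b = -T b a) ∧ ∀ a b, T (J x a) b = -J x (T a b) := by
  let ρ := ContinuousLinearMap.fst ℝ E (E →L[ℝ] ℝ)
  let ι := ContinuousLinearMap.inr ℝ E (E →L[ℝ] ℝ)
  let A := J' (extChartAt I x x)
  let D := fderiv ℝ J' (extChartAt I x x)
  -- The tensor is the torsion of jets with zero derivative; by `jetTorsion_eq_zero_jets` this
  -- choice loses nothing.
  let t (a b : E × (E →L[ℝ] ℝ)) : E × (E →L[ℝ] ℝ) :=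
    jetTorsion ρ ι (modelFlat E) A D a 0 b 0
  have hA (a : BigTangent I x) : A a = J x a := hJ.apply_self a
  have hAsq (a : E × (E →L[ℝ] ℝ)) : A (A a) = a :=
    (congrArg A (hA a)).trans ((hA _).trans (hsq x a))
  have hAskew (a b : E × (E →L[ℝ] ℝ)) : modelFlat E (A a) b = -modelFlat E a (A b) := by
    have h₁ : modelFlat E (A a) b = metric I (J x a) b :=
      congrArg (fun w => modelFlat E w b) (hA a)
    have h₂ : modelFlat E a (A b) = metric I a (J x b) := congrArg (modelFlat E a) (hA b)
    rw [h₁, h₂]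
    exact eq_neg_of_add_eq_zero_left (hskew a b)
  have hswap (a b) : t a b = -t b a := jetTorsion_swap _ _ _ _ _ _ _ _ _
  have hadd (a a' b) : t (a + a') b = t a b + t a' b := by
    have := jetTorsion_add_left ρ ι (modelFlat E) A D a a' b 0 0 0
    rwa [add_zero] at this
  have hsmul (c : ℝ) (a b) : t (c • a) b = c • t a b := by
    have := jetTorsion_smul_left ρ ι (modelFlat E) A D c a b 0 0
    rwa [smul_zero] at this
  have hadd' (a b b') : t a (b + b') = t a b + t a b' := by
    rw [hswap, hadd, neg_add, ← hswap, ← hswap]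
  have hsmul' (c : ℝ) (a b) : t a (c • b) = c • t a b := by
    rw [hswap, hsmul, hswap a b, smul_neg]
  let T : BigTangent I x →ₗ[ℝ] BigTangent I x →ₗ[ℝ] BigTangent I x :=
    LinearMap.mk₂ ℝ t hadd hsmul hadd' hsmul'
  have hT (e₁ e₂ : ∀ x : M, BigTangent I x) (h₁ : DiffAt I e₁ x) (h₂ : DiffAt I e₂ x) :
      torsion I J e₁ e₂ x = T (e₁ x) (e₂ x) :=
    (hJ.torsion_eq h₁ h₂).trans (jetTorsion_eq_zero_jets hAskew hAsq _ _ _ _ _)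
  refine ⟨T, hT, hswap, fun a b => ?_⟩
  -- The rule for `J` in the first slot is an identity between sections, so `a` and `b` are
  -- extended.
  obtain ⟨e₁, he₁, rfl⟩ := exists_smoothSection x a
  obtain ⟨e₂, he₂, rfl⟩ := exists_smoothSection x b
  have h := torsion_applyEndo_left hsq e₁ e₂ x
  rwa [hT _ _ (hJ.diffAt (he₁.diffAt I x)) (he₂.diffAt I x),
    hT _ _ (he₁.diffAt I x) (he₂.diffAt I x)] at h

end TorsionTensor

/-! ### Brackets of translation-invariant sections over `M × ℝ`. -/

section InvariantSections

variable {E : Type*} [NormedAddCommGroup E] [NormedSpace ℝ E]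
  {H : Type*} [TopologicalSpace H] (I : ModelWithCorners ℝ E H)
  {M : Type*} [TopologicalSpace M] [ChartedSpace H M]

/-- The translation-invariant section of the big tangent bundle of `M × ℝ` defined by a section
over `M`. -/
def pullBig (e : ∀ x : M, BigTangent I x) (p : M × ℝ) : BigTangent (I.prod 𝓘(ℝ, ℝ)) p :=
  inclBig I p (e p.1)

variable {I} [IsManifold I ∞ M] [I.Boundaryless] {e e₁ e₂ : ∀ x : M, BigTangent I x} {p : M × ℝ}

omit [IsManifold I ∞ M] in
theorem extChartAt_prod_symm_mem_source (p : M × ℝ) :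
    ∀ᶠ z in 𝓝 (extChartAt (I.prod 𝓘(ℝ, ℝ)) p p),
      ((extChartAt (I.prod 𝓘(ℝ, ℝ)) p).symm z).1 ∈ (chartAt H p.1).source := by
  have hfst : Tendsto Prod.fst (𝓝 (extChartAt (I.prod 𝓘(ℝ, ℝ)) p p)) (𝓝 (extChartAt I p.1 p.1)) :=
    (continuous_fst (X := E) (Y := ℝ)).tendsto _
  filter_upwards [hfst.eventually (extChartAt_symm_mem_source I p.1)] with z hz using hz

theorem hasFDerivAt_pullBig (he : DiffAt I e p.1) :
    HasFDerivAt (localRep (I.prod 𝓘(ℝ, ℝ)) p (pullBig I e))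
      ((modelIncl E).comp ((jet I e p.1).comp (ContinuousLinearMap.fst ℝ E ℝ)))
      (extChartAt (I.prod 𝓘(ℝ, ℝ)) p p) := by
  have h : HasFDerivAt (fun z : E × ℝ => modelIncl E (localRep I p.1 e z.1))
      ((modelIncl E).comp ((jet I e p.1).comp (ContinuousLinearMap.fst ℝ E ℝ)))
      (extChartAt (I.prod 𝓘(ℝ, ℝ)) p p) :=
    (modelIncl E).hasFDerivAt.comp _ (HasFDerivAt.comp (f := Prod.fst)
      (extChartAt (I.prod 𝓘(ℝ, ℝ)) p p) he.hasFDerivAt hasFDerivAt_fst)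
  refine h.congr_of_eventuallyEq ?_
  filter_upwards [extChartAt_prod_symm_mem_source (I := I) p] with z hz
  exact readFibre_incl I hz _

theorem DiffAt.pullBig (he : DiffAt I e p.1) : DiffAt (I.prod 𝓘(ℝ, ℝ)) (pullBig I e) p :=
  (hasFDerivAt_pullBig he).differentiableAt

theorem jet_pullBig (he : DiffAt I e p.1) : jet (I.prod 𝓘(ℝ, ℝ)) (GenParacontact.pullBig I e) p
    = (modelIncl E).comp ((jet I e p.1).comp (ContinuousLinearMap.fst ℝ E ℝ)) :=
  (hasFDerivAt_pullBig he).fderiv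

/-- The section `c ∂_t + d dt` of the big tangent bundle of `M × ℝ`. -/
def constBig (I : ModelWithCorners ℝ E H) (c d : ℝ) (p : M × ℝ) :
    BigTangent (I.prod 𝓘(ℝ, ℝ)) p :=
  (((0, c) : E × ℝ), d • ContinuousLinearMap.snd ℝ E ℝ)

theorem hasFDerivAt_constBig (c d : ℝ) (p : M × ℝ) :
    HasFDerivAt (localRep (I.prod 𝓘(ℝ, ℝ)) p (constBig I c d))
      (0 : E × ℝ →L[ℝ] (E × ℝ) × (E × ℝ →L[ℝ] ℝ))
      (extChartAt (I.prod 𝓘(ℝ, ℝ)) p p) := by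
  let v : (E × ℝ) × (E × ℝ →L[ℝ] ℝ) := ((0, c), d • ContinuousLinearMap.snd ℝ E ℝ)
  refine (hasFDerivAt_const (𝕜 := ℝ) v
    (extChartAt (I.prod 𝓘(ℝ, ℝ)) p p)).congr_of_eventuallyEq ?_
  filter_upwards [extChartAt_prod_symm_mem_source (I := I) p] with z hz
  exact readFibre_const I hz _ _

theorem diffAt_constBig (c d : ℝ) (p : M × ℝ) : DiffAt (I.prod 𝓘(ℝ, ℝ)) (constBig I c d) p :=
  (hasFDerivAt_constBig c d p).differentiableAt

theorem jet_constBig (c d : ℝ) (p : M × ℝ) : jet (I.prod 𝓘(ℝ, ℝ)) (constBig I c d) p = 0 :=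
  (hasFDerivAt_constBig c d p).fderiv

theorem courant_pullBig (h₁ : DiffAt I e₁ p.1) (h₂ : DiffAt I e₂ p.1) :
    courant (I.prod 𝓘(ℝ, ℝ)) (pullBig I e₁) (pullBig I e₂) p
      = inclBig I p (courant I e₁ e₂ p.1) := by
  rw [courant_eq_modelBracket _ h₁.pullBig h₂.pullBig, jet_pullBig h₁, jet_pullBig h₂,
    courant_eq_modelBracket _ h₁ h₂]
  exact modelBracket_incl (E := E) _ _ _ _

theorem courant_pullBig_constBig (he : DiffAt I e p.1) (c d : ℝ) :
    courant (I.prod 𝓘(ℝ, ℝ)) (pullBig I e) (constBig I c d) p = 0 := by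
  rw [courant_eq_modelBracket _ he.pullBig (diffAt_constBig c d p), jet_pullBig he, jet_constBig]
  exact modelBracket_incl_const (E := E) _ _ _ _

theorem courant_constBig_pullBig (he : DiffAt I e p.1) (c d : ℝ) :
    courant (I.prod 𝓘(ℝ, ℝ)) (constBig I c d) (pullBig I e) p = 0 := by
  rw [courant_swap (diffAt_constBig c d p) he.pullBig, courant_pullBig_constBig he, neg_zero]

theorem courant_constBig (c d c' d' : ℝ) (p : M × ℝ) :
    courant (I.prod 𝓘(ℝ, ℝ)) (constBig I c d) (constBig I c' d') p = 0 := by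
  rw [courant_eq_modelBracket _ (diffAt_constBig c d p) (diffAt_constBig c' d' p), jet_constBig,
    jet_constBig]
  simp [modelBracket, jetBracket]
  rfl

end InvariantSections

/-! ### Fibrewise algebra: `J` is a skew involution. -/

section ProductFibre

variable {E : Type*} [NormedAddCommGroup E] [NormedSpace ℝ E]
  {H : Type*} [TopologicalSpace H] {I : ModelWithCorners ℝ E H}
  {M : Type*} [TopologicalSpace M] [ChartedSpace H M]

theorem bigTangent_prod_decomp (p : M × ℝ) (v : BigTangent (I.prod 𝓘(ℝ, ℝ)) p) :
    v = inclBig I p (projBig I p v) + coeffDdt I p v • bigDdt I p + coeffDt I p v • bigDt I p := by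
  have h (v : (E × ℝ) × (E × ℝ →L[ℝ] ℝ)) : v = ((v.1.1, 0),
      (v.2.comp (ContinuousLinearMap.inl ℝ E ℝ)).comp (ContinuousLinearMap.fst ℝ E ℝ))
      + v.1.2 • (((0, 1) : E × ℝ), 0) + v.2 (0, 1) • (0, ContinuousLinearMap.snd ℝ E ℝ) := by
    refine Prod.ext (Prod.ext ?_ ?_) (ContinuousLinearMap.ext fun w => ?_)
    · simp
    · simp
    · have : w = (w.1, 0) + w.2 • ((0, 1) : E × ℝ) := by ext <;> simp
      conv_lhs => rw [this, map_add, map_smul]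
      simp [mul_comm]
  exact h v

theorem metric_prod (p : M × ℝ) (v w : BigTangent (I.prod 𝓘(ℝ, ℝ)) p) :
    metric (I.prod 𝓘(ℝ, ℝ)) v w = metric I (projBig I p v) (projBig I p w)
      + 1 / 2 * (coeffDt I p v * coeffDdt I p w + coeffDt I p w * coeffDdt I p v) := by
  have key (α : E × ℝ →L[ℝ] ℝ) (X : E × ℝ) : α X = α (X.1, 0) + α (0, 1) * X.2 := by
    have : X = (X.1, 0) + X.2 • ((0, 1) : E × ℝ) := by ext <;> simp
    conv_lhs => rw [this, map_add, map_smul, smul_eq_mul, mul_comm]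
  have h1 : v.2 w.1 = (projBig I p v).2 (projBig I p w).1 + coeffDt I p v * coeffDdt I p w :=
    key v.2 w.1
  have h2 : w.2 v.1 = (projBig I p w).2 (projBig I p v).1 + coeffDt I p w * coeffDdt I p v :=
    key w.2 v.1
  rw [metric, metric, h1, h2]
  ring

theorem projBig_inclBig (p : M × ℝ) (v : BigTangent I p.1) : projBig I p (inclBig I p v) = v := rfl

theorem coeffDdt_inclBig (p : M × ℝ) (v : BigTangent I p.1) : coeffDdt I p (inclBig I p v) = 0 :=
  rfl

theorem coeffDt_inclBig (p : M × ℝ) (v : BigTangent I p.1) : coeffDt I p (inclBig I p v) = 0 :=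
  map_zero v.2

theorem projBig_bigDdt (p : M × ℝ) : projBig I p (bigDdt I p) = 0 := rfl

theorem projBig_bigDt (p : M × ℝ) : projBig I p (bigDt I p) = 0 :=
  Prod.ext rfl (ContinuousLinearMap.ext fun _ => rfl)

theorem coeffDdt_bigDdt (p : M × ℝ) : coeffDdt I p (bigDdt I p) = 1 := rfl

theorem coeffDdt_bigDt (p : M × ℝ) : coeffDdt I p (bigDt I p) = 0 := rfl

theorem coeffDt_bigDdt (p : M × ℝ) : coeffDt I p (bigDdt I p) = 0 := rfl

theorem coeffDt_bigDt (p : M × ℝ) : coeffDt I p (bigDt I p) = 1 := rfl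

theorem bigTangent_prod_ext {p : M × ℝ} {v w : BigTangent (I.prod 𝓘(ℝ, ℝ)) p}
    (h : projBig I p v = projBig I p w) (h₁ : coeffDdt I p v = coeffDdt I p w)
    (h₂ : coeffDt I p v = coeffDt I p w) : v = w := by
  rw [bigTangent_prod_decomp p v, h, h₁, h₂, ← bigTangent_prod_decomp p w]

variable (F : ∀ x : M, BigTangent I x →L[ℝ] BigTangent I x) (Z : ∀ x : M, TangentSpace I x)
  (ξ : ∀ x : M, CotangentSpace I x)

theorem projBig_productEndo (p : M × ℝ) (v : BigTangent (I.prod 𝓘(ℝ, ℝ)) p) :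
    projBig I p (productEndo I F Z ξ p v) = F p.1 (projBig I p v)
      + coeffDt I p v • (Z p.1, 0) - coeffDdt I p v • (0, ξ p.1) := by
  rw [productEndo_apply, ContinuousLinearMap.map_add, ContinuousLinearMap.map_sub,
    ContinuousLinearMap.map_sub, ContinuousLinearMap.map_add, ContinuousLinearMap.map_smul,
    ContinuousLinearMap.map_smul, ContinuousLinearMap.map_smul, ContinuousLinearMap.map_smul,
    projBig_inclBig, projBig_inclBig, projBig_inclBig, projBig_bigDdt, projBig_bigDt, smul_zero,
    smul_zero, sub_zero, add_zero]

theorem coeffDdt_productEndo (p : M × ℝ) (v : BigTangent (I.prod 𝓘(ℝ, ℝ)) p) :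
    coeffDdt I p (productEndo I F Z ξ p v) = -(projBig I p v).2 (Z p.1) := by
  rw [productEndo_apply, ContinuousLinearMap.map_add, ContinuousLinearMap.map_sub,
    ContinuousLinearMap.map_sub, ContinuousLinearMap.map_add, ContinuousLinearMap.map_smul,
    ContinuousLinearMap.map_smul, ContinuousLinearMap.map_smul, ContinuousLinearMap.map_smul,
    coeffDdt_inclBig, coeffDdt_inclBig, coeffDdt_inclBig, coeffDdt_bigDdt, coeffDdt_bigDt]
  simp

theorem coeffDt_productEndo (p : M × ℝ) (v : BigTangent (I.prod 𝓘(ℝ, ℝ)) p) :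
    coeffDt I p (productEndo I F Z ξ p v) = ξ p.1 (projBig I p v).1 := by
  rw [productEndo_apply, ContinuousLinearMap.map_add, ContinuousLinearMap.map_sub,
    ContinuousLinearMap.map_sub, ContinuousLinearMap.map_add, ContinuousLinearMap.map_smul,
    ContinuousLinearMap.map_smul, ContinuousLinearMap.map_smul, ContinuousLinearMap.map_smul,
    coeffDt_inclBig, coeffDt_inclBig, coeffDt_inclBig, coeffDt_bigDdt, coeffDt_bigDt]
  simp

theorem productEndo_inclBig (p : M × ℝ) (v : BigTangent I p.1) :
    productEndo I F Z ξ p (inclBig I p v)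
      = inclBig I p (F p.1 v) - v.2 (Z p.1) • bigDdt I p + ξ p.1 v.1 • bigDt I p := by
  rw [productEndo_apply, coeffDt_inclBig, coeffDdt_inclBig, projBig_inclBig, zero_smul, zero_smul,
    add_zero, sub_zero]

theorem productEndo_constBig (p : M × ℝ) (c d : ℝ) :
    productEndo I F Z ξ p (constBig I c d p)
      = inclBig I p (d • (Z p.1, 0) - c • (0, ξ p.1)) := by
  have hp : projBig I p (constBig I c d p) = 0 :=
    Prod.ext rfl (ContinuousLinearMap.ext fun _ => mul_zero d)
  have h1 : coeffDt I p (constBig I c d p) = d := mul_one d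
  have h2 : coeffDdt I p (constBig I c d p) = c := rfl
  refine bigTangent_prod_ext ?_ ?_ ?_
  · rw [projBig_productEndo, hp, h1, h2, projBig_inclBig, ContinuousLinearMap.map_zero, zero_add]
  · rw [coeffDdt_productEndo, hp, coeffDdt_inclBig]
    exact neg_zero
  · rw [coeffDt_productEndo, hp, coeffDt_inclBig]
    exact (ξ p.1).map_zero

theorem metric_comm {x : M} (a b : BigTangent I x) : metric I a b = metric I b a :=
  congrArg (1 / 2 * ·) (add_comm _ _)

theorem metric_add_sub {x : M} (a b : BigTangent I x) (u : TangentSpace I x)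
    (α : CotangentSpace I x) (c d : ℝ) :
    metric I (a + c • (u, 0) - d • (0, α)) b
      = metric I a b + 1 / 2 * (c * b.2 u - d * α b.1) := by
  have h₁ : (a + c • (u, 0) - d • (0, α)).2 b.1 = a.2 b.1 + c * 0 - d * α b.1 := rfl
  have h₂ : b.2 (a + c • (u, 0) - d • (0, α)).1 = b.2 a.1 + c * b.2 u - d * b.2 0 := by
    change b.2 (a.1 + c • u - d • 0) = _
    rw [map_sub, map_add, map_smul, map_smul, smul_eq_mul, smul_eq_mul]
  rw [metric, metric, h₁, h₂, map_zero]
  ring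

theorem smul_pair_eq_add {V W : Type*} [AddCommGroup V] [Module ℝ V] [AddCommGroup W] [Module ℝ W]
    (c d : ℝ) (v : V) (w : W) : (c • v, d • w) = c • (v, (0 : W)) + d • ((0 : V), w) := by
  simp

theorem cancel_components {V : Type*} [AddCommGroup V] [Module ℝ V] (a u w : V) (c d : ℝ) :
    a - (c • u + d • w) + 0 - 0 + c • u - -d • w = a := by
  rw [neg_smul]; abel

variable {F Z ξ} [IsManifold I ∞ M]

namespace IsAlmostParacontact
variable {x : M} {p : M × ℝ}

/-- Skewness moves `F` onto `(Z, 0)`, which it kills. With `form_apply_fst`, this makes `im F`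
orthogonal to `(Z, 0)` and `(0, ξ)`, so that `𝔷` vanishes on it and `F² = I` there. -/
theorem snd_apply_vector (h : IsAlmostParacontact I F Z ξ) (a : BigTangent I x) :
    (F x a).2 (Z x) = 0 := by
  have := h.skew x a (Z x, 0)
  rw [h.apply_vector] at this
  simpa [metric] using this

theorem form_apply_fst (h : IsAlmostParacontact I F Z ξ) (a : BigTangent I x) :
    ξ x (F x a).1 = 0 := by
  have := h.skew x a (0, ξ x)
  rw [h.apply_form] at this
  simpa [metric] using this

theorem apply_apply (h : IsAlmostParacontact I F Z ξ) (a : BigTangent I x) :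
    F x (F x a) = a - (ξ x a.1 • (Z x, 0) + a.2 (Z x) • (0, ξ x)) := by
  have := congrArg (fun A : BigTangent I x →L[ℝ] BigTangent I x => A a) (h.sq x)
  refine this.trans (congrArg (fun b => a - b) ?_)
  exact smul_pair_eq_add (ξ x a.1) (a.2 (Z x)) (Z x) (ξ x)

theorem apply_apply_of_mem_range (h : IsAlmostParacontact I F Z ξ)
    {a : BigTangent I x} (ha : a ∈ range (F x)) :
    F x (F x a) = a := by
  obtain ⟨b, rfl⟩ := ha
  rw [h.apply_apply, h.form_apply_fst, h.snd_apply_vector, zero_smul, zero_smul, add_zero,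
    sub_zero]

theorem productEndo_productEndo (h : IsAlmostParacontact I F Z ξ)
    (v : BigTangent (I.prod 𝓘(ℝ, ℝ)) p) :
    productEndo I F Z ξ p (productEndo I F Z ξ p v) = v := by
  refine bigTangent_prod_ext ?_ ?_ ?_
  · rw [projBig_productEndo, projBig_productEndo, coeffDt_productEndo, coeffDdt_productEndo,
      ContinuousLinearMap.map_sub, ContinuousLinearMap.map_add, ContinuousLinearMap.map_smul,
      ContinuousLinearMap.map_smul, h.apply_vector, h.apply_form, h.apply_apply, smul_zero,
      smul_zero]
    exact cancel_components _ _ _ _ _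
  · rw [coeffDdt_productEndo, projBig_productEndo]
    change -((F p.1 (projBig I p v)).2 (Z p.1) + coeffDt I p v * 0
      - coeffDdt I p v * ξ p.1 (Z p.1)) = _
    rw [h.snd_apply_vector, h.pairing]
    ring
  · rw [coeffDt_productEndo, projBig_productEndo]
    change ξ p.1 ((F p.1 (projBig I p v)).1 + coeffDt I p v • Z p.1 - coeffDdt I p v • 0) = _
    rw [smul_zero, sub_zero, map_add, map_smul, h.form_apply_fst, h.pairing]
    simp

theorem productEndo_skew (h : IsAlmostParacontact I F Z ξ) (v w : BigTangent (I.prod 𝓘(ℝ, ℝ)) p) :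
    metric (I.prod 𝓘(ℝ, ℝ)) (productEndo I F Z ξ p v) w
      + metric (I.prod 𝓘(ℝ, ℝ)) v (productEndo I F Z ξ p w) = 0 := by
  rw [metric_prod, metric_prod, projBig_productEndo, projBig_productEndo, coeffDt_productEndo,
    coeffDt_productEndo, coeffDdt_productEndo, coeffDdt_productEndo]
  have := h.skew p.1 (projBig I p v) (projBig I p w)
  rw [metric_comm (projBig I p v) (_ - _), metric_add_sub, metric_add_sub,
    metric_comm (F p.1 (projBig I p w))]
  linear_combination this

end IsAlmostParacontact

end ProductFibre

/-! ### Torsion of `J` on generators, in terms of brackets on `M`. -/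

section Integrability

variable {E : Type*} [NormedAddCommGroup E] [NormedSpace ℝ E]
  {H : Type*} [TopologicalSpace H] {I : ModelWithCorners ℝ E H}
  {M : Type*} [TopologicalSpace M] [ChartedSpace H M] [IsManifold I ∞ M]
  {F : ∀ x : M, BigTangent I x →L[ℝ] BigTangent I x} {Z : ∀ x : M, TangentSpace I x}
  {ξ : ∀ x : M, CotangentSpace I x}

theorem zero_sub_neg_one_smul {V : Type*} [AddCommGroup V] [Module ℝ V] (v : V) :
    0 - (-1 : ℝ) • v = v := by
  simp

namespace IsAlmostParacontact

omit [IsManifold I ∞ M] in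
theorem applyEndo_vector (p : M × ℝ) :
    productEndo I F Z ξ p (constBig I 0 1 p) = inclBig I p (Z p.1, 0) := by
  rw [productEndo_constBig, zero_smul, one_smul, sub_zero]

omit [IsManifold I ∞ M] in
-- The generator is `-∂_t` rather than `∂_t` because `J ∂_t = -(0, ξ)`.
theorem applyEndo_form (p : M × ℝ) :
    productEndo I F Z ξ p (constBig I (-1) 0 p) = inclBig I p (0, ξ p.1) := by
  rw [productEndo_constBig, zero_smul]
  exact congrArg (inclBig I p) (zero_sub_neg_one_smul (V := E × (E →L[ℝ] ℝ)) _)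

omit [IsManifold I ∞ M] in
-- Torsions on generators involving `im F` have this form; projecting to `TM ⊕ T*M`, `∂_t` and `dt`
-- separates the equation on `M` from two scalar conditions.
theorem inclBig_sub_eq_zero_iff {p : M × ℝ} {P S : BigTangent I p.1} :
    inclBig I p P - productEndo I F Z ξ p (inclBig I p S) = 0 ↔
      P = F p.1 S ∧ S.2 (Z p.1) = 0 ∧ ξ p.1 S.1 = 0 := by
  rw [sub_eq_zero, productEndo_inclBig]
  constructor
  · intro h
    have h1 := congrArg (projBig I p) h
    have h2 := congrArg (coeffDdt I p) h
    have h3 := congrArg (coeffDt I p) h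
    simp only [ContinuousLinearMap.map_add, ContinuousLinearMap.map_sub,
      ContinuousLinearMap.map_smul, projBig_inclBig, projBig_bigDdt, projBig_bigDt,
      coeffDdt_inclBig, coeffDdt_bigDdt, coeffDdt_bigDt, coeffDt_inclBig, coeffDt_bigDdt,
      coeffDt_bigDt, smul_zero, sub_zero, add_zero, smul_eq_mul, mul_one, mul_zero, zero_sub,
      zero_add] at h1 h2 h3
    exact ⟨h1, by linarith, h3.symm⟩
  · rintro ⟨rfl, h2, h3⟩
    rw [h2, h3, zero_smul, zero_smul, sub_zero, add_zero]

/-- Stability under `J` adds `(Z, 0) = J dt` and `(0, ξ) = J(-∂_t)`; then `a = F(F a) + 𝔷 a` reaches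
every element coming from `M`. -/
theorem submodule_eq_top (h : IsAlmostParacontact I F Z ξ) {p : M × ℝ}
    {W : Submodule ℝ (BigTangent (I.prod 𝓘(ℝ, ℝ)) p)} (h₁ : ∀ a, inclBig I p (F p.1 a) ∈ W)
    (h₂ : constBig I (-1) 0 p ∈ W) (h₃ : constBig I 0 1 p ∈ W)
    (hJ : ∀ w ∈ W, productEndo I F Z ξ p w ∈ W) (v : BigTangent (I.prod 𝓘(ℝ, ℝ)) p) : v ∈ W := by
  have hZ : inclBig I p (Z p.1, 0) ∈ W := applyEndo_vector (F := F) (ξ := ξ) p ▸ hJ _ h₃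
  have hξ : inclBig I p (0, ξ p.1) ∈ W := applyEndo_form (F := F) (Z := Z) p ▸ hJ _ h₂
  have hddt : bigDdt I p ∈ W := by
    have e : (((0, 1), 0) : (E × ℝ) × (E × ℝ →L[ℝ] ℝ))
        = (-1 : ℝ) • ((0, -1), (0 : ℝ) • ContinuousLinearMap.snd ℝ E ℝ) := by
      refine Prod.ext (Prod.ext ?_ ?_) ?_ <;> simp
    have e : bigDdt I p = (-1 : ℝ) • constBig I (-1) 0 p := e
    exact e ▸ W.smul_mem _ h₂
  have hdt : bigDt I p ∈ W := by
    have e : bigDt I p = constBig I 0 1 p :=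
      Prod.ext rfl (one_smul ℝ (ContinuousLinearMap.snd ℝ E ℝ)).symm
    exact e ▸ h₃
  have ha (a : BigTangent I p.1) : inclBig I p a ∈ W := by
    have e : a = F p.1 (F p.1 a) + (ξ p.1 a.1 • (Z p.1, 0) + a.2 (Z p.1) • (0, ξ p.1)) := by
      rw [h.apply_apply, sub_add_cancel]
    rw [e, ContinuousLinearMap.map_add, ContinuousLinearMap.map_add, ContinuousLinearMap.map_smul,
      ContinuousLinearMap.map_smul]
    exact W.add_mem (h₁ _) (W.add_mem (W.smul_mem _ hZ) (W.smul_mem _ hξ))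
  rw [bigTangent_prod_decomp p v]
  exact W.add_mem (W.add_mem (ha _) (W.smul_mem _ hddt)) (W.smul_mem _ hdt)

/-- On `im F` the `∂_t` and `dt` components of `J` vanish by orthogonality, so `J` acts as `F`. -/
theorem applyEndo_pullBig (h : IsAlmostParacontact I F Z ξ) {e : ∀ x : M, BigTangent I x}
    (he : IsSectionOfImage I F e) :
    applyEndo (I.prod 𝓘(ℝ, ℝ)) (productEndo I F Z ξ) (pullBig I e)
      = pullBig I (applyEndo I F e) := by
  funext p
  obtain ⟨b, hb⟩ := he.2 p.1
  rw [applyEndo, pullBig, productEndo_inclBig, ← hb, h.snd_apply_vector, h.form_apply_fst,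
    zero_smul, zero_smul, sub_zero, add_zero, hb]
  rfl

theorem sectionOfImage_applyEndo (h : IsAlmostParacontact I F Z ξ) {e : ∀ x : M, BigTangent I x}
    (he : IsSmoothSection I e) : IsSectionOfImage I F (applyEndo I F e) :=
  ⟨h.smooth_endo.smoothSection he, fun x => ⟨e x, rfl⟩⟩

theorem applyEndo_applyEndo (h : IsAlmostParacontact I F Z ξ) {e : ∀ x : M, BigTangent I x}
    (he : IsSectionOfImage I F e) : applyEndo I F (applyEndo I F e) = e :=
  funext fun x => h.apply_apply_of_mem_range (he.2 x)

theorem exists_sectionOfImage [FiniteDimensional ℝ E] [T2Space M] [SigmaCompactSpace M]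
    (h : IsAlmostParacontact I F Z ξ) {x : M} {a : BigTangent I x} (ha : a ∈ range (F x)) :
    ∃ e, IsSectionOfImage I F e ∧ e x = a := by
  obtain ⟨b, rfl⟩ := ha
  obtain ⟨e, he, rfl⟩ := exists_smoothSection x b
  exact ⟨_, h.sectionOfImage_applyEndo he, rfl⟩

variable [I.Boundaryless]

theorem torsion_pullBig (h : IsAlmostParacontact I F Z ξ) {e₁ e₂ : ∀ x : M, BigTangent I x}
    (h₁ : IsSectionOfImage I F e₁) (h₂ : IsSectionOfImage I F e₂) (p : M × ℝ) :
    torsion (I.prod 𝓘(ℝ, ℝ)) (productEndo I F Z ξ) (pullBig I e₁) (pullBig I e₂) p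
      = inclBig I p (courant I (applyEndo I F e₁) (applyEndo I F e₂) p.1 + courant I e₁ e₂ p.1)
        - productEndo I F Z ξ p (inclBig I p (courant I (applyEndo I F e₁) e₂ p.1
          + courant I e₁ (applyEndo I F e₂) p.1)) := by
  have d₁ := h₁.1.diffAt I p.1
  have d₂ := h₂.1.diffAt I p.1
  have d₁' := (h.sectionOfImage_applyEndo h₁.1).1.diffAt I p.1
  have d₂' := (h.sectionOfImage_applyEndo h₂.1).1.diffAt I p.1
  rw [torsion, h.applyEndo_pullBig h₁, h.applyEndo_pullBig h₂, courant_pullBig d₁' d₂',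
    courant_pullBig d₁' d₂, courant_pullBig d₁ d₂', courant_pullBig d₁ d₂,
    ContinuousLinearMap.map_add (inclBig I p), ContinuousLinearMap.map_add (inclBig I p)]
  abel

theorem torsion_pullBig_constBig (h : IsAlmostParacontact I F Z ξ) {e s : ∀ x : M, BigTangent I x}
    (he : IsSectionOfImage I F e) {c d : ℝ} {p : M × ℝ} (hs : DiffAt I s p.1)
    (hcd : applyEndo (I.prod 𝓘(ℝ, ℝ)) (productEndo I F Z ξ) (constBig I c d) = pullBig I s) :
    torsion (I.prod 𝓘(ℝ, ℝ)) (productEndo I F Z ξ) (pullBig I e) (constBig I c d) p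
      = inclBig I p (courant I (applyEndo I F e) s p.1)
        - productEndo I F Z ξ p (inclBig I p (courant I e s p.1)) := by
  have d₁ := he.1.diffAt I p.1
  have d₁' := (h.sectionOfImage_applyEndo he.1).1.diffAt I p.1
  rw [torsion, h.applyEndo_pullBig he, hcd, courant_pullBig d₁' hs, courant_pullBig d₁ hs,
    courant_pullBig_constBig d₁', courant_pullBig_constBig d₁, zero_add, add_zero]

theorem torsion_constBig {s s' : ∀ x : M, BigTangent I x} {c d c' d' : ℝ} {p : M × ℝ}
    (hs : DiffAt I s p.1) (hs' : DiffAt I s' p.1)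
    (hcd : applyEndo (I.prod 𝓘(ℝ, ℝ)) (productEndo I F Z ξ) (constBig I c d) = pullBig I s)
    (hcd' : applyEndo (I.prod 𝓘(ℝ, ℝ)) (productEndo I F Z ξ) (constBig I c' d') = pullBig I s') :
    torsion (I.prod 𝓘(ℝ, ℝ)) (productEndo I F Z ξ) (constBig I c d) (constBig I c' d') p
      = inclBig I p (courant I s s' p.1) := by
  rw [torsion, hcd, hcd', courant_pullBig hs hs', courant_pullBig_constBig hs,
    courant_constBig_pullBig hs', courant_constBig, add_zero, add_zero,
    ContinuousLinearMap.map_zero, sub_zero]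

end IsAlmostParacontact

end Integrability

/-! ### The bracket of `(0, ξ)` with `(Z, 0)` vanishes. -/

section Components

variable {E : Type*} [NormedAddCommGroup E] [NormedSpace ℝ E]
  {H : Type*} [TopologicalSpace H] {I : ModelWithCorners ℝ E H}
  {M : Type*} [TopologicalSpace M] [ChartedSpace H M] [IsManifold I ∞ M]
  {e : ∀ x : M, BigTangent I x} {x : M}

namespace DiffAt

theorem hasFDerivAt_vectorPart (he : DiffAt I e x) :
    HasFDerivAt (localRep I x (fun y => ((e y).1, 0)))
      (((ContinuousLinearMap.inl ℝ E (E →L[ℝ] ℝ)).comp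
        (ContinuousLinearMap.fst ℝ E (E →L[ℝ] ℝ))).comp (jet I e x)) (extChartAt I x x) := by
  have h : localRep I x (fun y => ((e y).1, 0)) = fun z => ((ContinuousLinearMap.inl ℝ E
      (E →L[ℝ] ℝ)).comp (ContinuousLinearMap.fst ℝ E (E →L[ℝ] ℝ))) (localRep I x e z) :=
    funext fun z => Prod.ext rfl (ContinuousLinearMap.ext fun _ => rfl)
  rw [h]
  exact (ContinuousLinearMap.hasFDerivAt _).comp _ he.hasFDerivAt

theorem hasFDerivAt_formPart (he : DiffAt I e x) :
    HasFDerivAt (localRep I x (fun y => (0, (e y).2)))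
      (((ContinuousLinearMap.inr ℝ E (E →L[ℝ] ℝ)).comp
        (ContinuousLinearMap.snd ℝ E (E →L[ℝ] ℝ))).comp (jet I e x)) (extChartAt I x x) := by
  have h : localRep I x (fun y => (0, (e y).2)) = fun z => ((ContinuousLinearMap.inr ℝ E
      (E →L[ℝ] ℝ)).comp (ContinuousLinearMap.snd ℝ E (E →L[ℝ] ℝ))) (localRep I x e z) :=
    funext fun z => Prod.ext (ContinuousLinearMap.map_zero _) rfl
  rw [h]
  exact (ContinuousLinearMap.hasFDerivAt _).comp _ he.hasFDerivAt

theorem vectorPart (he : DiffAt I e x) : DiffAt I (fun y => ((e y).1, 0)) x :=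
  he.hasFDerivAt_vectorPart.differentiableAt

theorem formPart (he : DiffAt I e x) : DiffAt I (fun y => (0, (e y).2)) x :=
  he.hasFDerivAt_formPart.differentiableAt

theorem jet_vectorPart (he : DiffAt I e x) (v : E) :
    jet I (fun y => ((e y).1, 0)) x v = ((jet I e x v).1, 0) :=
  congrArg (fun A : E →L[ℝ] E × (E →L[ℝ] ℝ) => A v) he.hasFDerivAt_vectorPart.fderiv

theorem jet_formPart (he : DiffAt I e x) (v : E) :
    jet I (fun y => (0, (e y).2)) x v = (0, (jet I e x v).2) :=
  congrArg (fun A : E →L[ℝ] E × (E →L[ℝ] ℝ) => A v) he.hasFDerivAt_formPart.fderiv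

end DiffAt

omit [IsManifold I ∞ M] in
theorem differential_const {f : M → ℝ} {c : ℝ} (hf : ∀ y, f y = c) (x : M) :
    differential I f x = 0 := by
  have h : f = fun _ => c := funext hf
  rw [differential, h]
  exact mfderiv_const

variable {F : ∀ x : M, BigTangent I x →L[ℝ] BigTangent I x} {Z : ∀ x : M, TangentSpace I x}
  {ξ : ∀ x : M, CotangentSpace I x} [I.Boundaryless]

/-- Here `D` is the jet of `(Z, ξ)`: `hpair` is the derivative of `ξ(Z) = 1`, and `hd` says `i_Z dξ
= 0`. Given `hpair`, the bracket reduces to `-i_Z dξ`. -/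
theorem modelBracket_form_vector (D : E →L[ℝ] E × (E →L[ℝ] ℝ)) (K L : E →L[ℝ] E × (E →L[ℝ] ℝ))
    (z : E) (α : E →L[ℝ] ℝ) (hK : ∀ v, K v = (0, (D v).2)) (hL : ∀ v, L v = ((D v).1, 0))
    (hpair : ∀ v, α (D v).1 + (D v).2 z = 0) (hd : ∀ v, (D z).2 v = (D v).2 z) :
    modelBracket (E := E) (0, α) K (z, 0) L = 0 := by
  refine Prod.ext ?_ (ContinuousLinearMap.ext fun v => ?_)
  · change (L 0).1 - (K z).1 + 0 = 0
    rw [hK, map_zero]; simp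
  · change ((L 0).2 v - (K z).2 v) + (1 / 2 * ((0 : E →L[ℝ] ℝ) (K v).1 + (K v).2 z)
          - 1 / 2 * (α (L v).1 + (L v).2 0)) = 0
    have h₀ : (0 : E × (E →L[ℝ] ℝ)).2 v = 0 := rfl
    rw [hK, hK, map_zero, h₀, show (L v).1 = (D v).1 by rw [hL]]
    simp only [map_zero, hd]
    linarith [hpair v]

theorem form_eq_of_vanishing {V : Type*} [AddCommGroup V] [Module ℝ V] {B C : V →ₗ[ℝ] ℝ}
    {α : V →ₗ[ℝ] ℝ} {z : V} (hα : α z = 1) (hz : B z = C z) (h : ∀ v, α v = 0 → B v = C v)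
    (v : V) : B v = C v := by
  have := h (v - α v • z) (by simp [hα])
  rw [map_sub, map_sub, map_smul, map_smul, hz] at this
  exact sub_left_injective this

theorem IsAlmostParacontact.pairing_jet (h : IsAlmostParacontact I F Z ξ) (x : M) (v : E) :
    ξ x (jet I (fun y => (Z y, ξ y)) x v).1 + (jet I (fun y => (Z y, ξ y)) x v).2 (Z x) = 0 := by
  have hs := h.smooth_section.diffAt I x
  refine (differential_pairing I hs hs v).symm.trans ?_
  rw [differential_const h.pairing]
  rfl

/-- This is `dξ(Z, v) = 0` for `v` in `ker ξ`. Such a `(v, 0)` equals `F²(v, 0)`, so it extends to a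
section `e = (X, α)` of `im F`. Then `ξ(X) = 0` and `ξ(Z) = 1` are constant, and `ξ([X, Z]) = 0`;
differentiating gives the claim. -/
theorem IsAlmostParacontact.closed_jet [FiniteDimensional ℝ E] [T2Space M] [SigmaCompactSpace M]
    (h : IsAlmostParacontact I F Z ξ)
    (hZ : ∀ e, IsSectionOfImage I F e → ∀ x,
      courant I (applyEndo I F e) (fun y => (Z y, 0)) x = F x (courant I e (fun y => (Z y, 0)) x))
    (x : M) {v : TangentSpace I x} (hv : ξ x v = 0) :
    (jet I (fun y => (Z y, ξ y)) x (Z x)).2 v = (jet I (fun y => (Z y, ξ y)) x v).2 (Z x) := by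
  have hs := h.smooth_section.diffAt I x
  have hv' : ((v, 0) : BigTangent I x) ∈ range (F x) := by
    refine ⟨F x (v, 0), ?_⟩
    rw [h.apply_apply, hv]
    change (v, 0) - ((0 : ℝ) • (Z x, 0) + (0 : ℝ) • (0, ξ x)) = _
    rw [zero_smul, zero_smul, add_zero, sub_zero]
  obtain ⟨e, he, hex⟩ := h.exists_sectionOfImage hv'
  have hd := he.1.diffAt I x
  have h₁ : ξ x (jet I e x (Z x)).1 + (jet I (fun y => (Z y, ξ y)) x (Z x)).2 v = 0 := by
    have hc : ∀ y, ξ y (e y).1 = 0 := fun y => by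
      obtain ⟨b, hb⟩ := he.2 y
      rw [← hb, h.form_apply_fst]
    have := differential_pairing I hd hs (Z x)
    rw [differential_const hc, hex] at this
    exact this.symm
  have h₂ : ξ x (courant I e (fun y => (Z y, 0)) x).1 = 0 := by
    -- Applied to `F e`: as `F(F e) = e`, this exhibits the bracket of `e` itself as an element of
    -- `im F`.
    have := hZ _ (h.sectionOfImage_applyEndo he.1) x
    rw [h.applyEndo_applyEndo he] at this
    rw [this, h.form_apply_fst]
  have h₃ : (courant I e (fun y => (Z y, 0)) x).1
      = (jet I (fun y => (Z y, ξ y)) x v).1 - (jet I e x (Z x)).1 := by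
    refine (mlieBracket_eq_jet I hd hs.vectorPart).trans ?_
    rw [hex]
    have := congrArg (fun w : E × (E →L[ℝ] ℝ) => w.1 - (jet I e x (Z x)).1) (hs.jet_vectorPart v)
    exact this
  have h₄ := h.pairing_jet x v
  have h₅ : ξ x (jet I (fun y => (Z y, ξ y)) x v).1 - ξ x (jet I e x (Z x)).1 = 0 := by
    rw [← h₂, h₃]
    exact ((ξ x).map_sub _ _).symm
  linarith

theorem IsAlmostParacontact.courant_form_vector [FiniteDimensional ℝ E] [T2Space M]
    [SigmaCompactSpace M] (h : IsAlmostParacontact I F Z ξ)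
    (hZ : ∀ e, IsSectionOfImage I F e → ∀ x,
      courant I (applyEndo I F e) (fun y => (Z y, 0)) x = F x (courant I e (fun y => (Z y, 0)) x))
    (x : M) : courant I (fun y => (0, ξ y)) (fun y => (Z y, 0)) x = 0 := by
  have hs := h.smooth_section.diffAt I x
  rw [courant_eq_modelBracket I hs.formPart hs.vectorPart]
  let D : E →L[ℝ] E × (E →L[ℝ] ℝ) := jet I (fun y => (Z y, ξ y)) x
  refine modelBracket_form_vector D _ _ (Z x) (ξ x) hs.jet_formPart hs.jet_vectorPart
    (h.pairing_jet x) ?_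
  -- `dξ(Z, Z) = 0` is trivial and `E` is spanned by `Z` and `ker ξ`, so `closed_jet` suffices.
  refine form_eq_of_vanishing (V := E) (B := (D (Z x)).2.toLinearMap)
    (C := (((ContinuousLinearMap.snd ℝ E (E →L[ℝ] ℝ)).comp D).flip (Z x)).toLinearMap)
    (α := (ξ x).toLinearMap) (h.pairing x) rfl fun v hv => h.closed_jet hZ x hv

end Components

/-! ### Integrability of `J` is equivalent to three bracket identities on `M`. -/

section Integrability

variable {E : Type*} [NormedAddCommGroup E] [NormedSpace ℝ E]
  {H : Type*} [TopologicalSpace H] {I : ModelWithCorners ℝ E H}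
  {M : Type*} [TopologicalSpace M] [ChartedSpace H M] [IsManifold I ∞ M] [I.Boundaryless]
  {F : ∀ x : M, BigTangent I x →L[ℝ] BigTangent I x} {Z : ∀ x : M, TangentSpace I x}
  {ξ : ∀ x : M, CotangentSpace I x}

theorem eq_zero_of_eq_neg {V : Type*} [AddCommGroup V] [Module ℝ V] {v : V} (h : v = -v) :
    v = 0 := by
  have h₂ : (2 : ℝ) • v = 0 := by rw [two_smul, eq_neg_iff_add_eq_zero.1 h]
  exact (smul_eq_zero.1 h₂).resolve_left two_ne_zero

namespace IsAlmostParacontact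

omit [IsManifold I ∞ M] [I.Boundaryless] in
theorem applyEndo_vector_eq : applyEndo (I.prod 𝓘(ℝ, ℝ)) (productEndo I F Z ξ) (constBig I 0 1)
    = pullBig I (fun y => (Z y, 0)) := funext applyEndo_vector

omit [IsManifold I ∞ M] [I.Boundaryless] in
theorem applyEndo_form_eq : applyEndo (I.prod 𝓘(ℝ, ℝ)) (productEndo I F Z ξ) (constBig I (-1) 0)
    = pullBig I (fun y => (0, ξ y)) := funext applyEndo_form

theorem torsion_pullBig_eq_zero (h : IsAlmostParacontact I F Z ξ)
    (hA : ∀ e₁ e₂, IsSectionOfImage I F e₁ → IsSectionOfImage I F e₂ → ∀ x,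
        courant I (applyEndo I F e₁) (applyEndo I F e₂) x + courant I e₁ e₂ x
          = F x (courant I (applyEndo I F e₁) e₂ x + courant I e₁ (applyEndo I F e₂) x))
    {e₁ e₂ : ∀ x : M, BigTangent I x} (h₁ : IsSectionOfImage I F e₁)
    (h₂ : IsSectionOfImage I F e₂) (p : M × ℝ) :
    torsion (I.prod 𝓘(ℝ, ℝ)) (productEndo I F Z ξ) (pullBig I e₁) (pullBig I e₂) p = 0 := by
  rw [h.torsion_pullBig h₁ h₂, inclBig_sub_eq_zero_iff]
  -- With `F e₁` in place of `e₁`, the identity shows that the argument of `F` in `hA` lies in `im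
  -- F`, which yields both scalar conditions.
  have h' := hA _ e₂ (h.sectionOfImage_applyEndo h₁.1) h₂ p.1
  rw [h.applyEndo_applyEndo h₁, add_comm] at h'
  exact ⟨hA e₁ e₂ h₁ h₂ p.1, by rw [h', h.snd_apply_vector], by rw [h', h.form_apply_fst]⟩

theorem torsion_pullBig_constBig_eq_zero (h : IsAlmostParacontact I F Z ξ) {c d : ℝ}
    {s : ∀ x : M, BigTangent I x} {p : M × ℝ} (hs : DiffAt I s p.1)
    (hcd : applyEndo (I.prod 𝓘(ℝ, ℝ)) (productEndo I F Z ξ) (constBig I c d) = pullBig I s)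
    (hC : ∀ e, IsSectionOfImage I F e → ∀ x,
      courant I (applyEndo I F e) s x = F x (courant I e s x))
    {e : ∀ x : M, BigTangent I x} (he : IsSectionOfImage I F e) :
    torsion (I.prod 𝓘(ℝ, ℝ)) (productEndo I F Z ξ) (pullBig I e) (constBig I c d) p = 0 := by
  rw [h.torsion_pullBig_constBig he hs hcd, inclBig_sub_eq_zero_iff]
  have h' := hC _ (h.sectionOfImage_applyEndo he.1) p.1
  rw [h.applyEndo_applyEndo he] at h'
  exact ⟨hC e he p.1, by rw [h', h.snd_apply_vector], by rw [h', h.form_apply_fst]⟩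

variable [FiniteDimensional ℝ E] [T2Space M] [SigmaCompactSpace M]

theorem exists_torsionTensor_productEndo (h : IsAlmostParacontact I F Z ξ) (p : M × ℝ) :
    ∃ T : BigTangent (I.prod 𝓘(ℝ, ℝ)) p →ₗ[ℝ]
      BigTangent (I.prod 𝓘(ℝ, ℝ)) p →ₗ[ℝ] BigTangent (I.prod 𝓘(ℝ, ℝ)) p,
      (∀ e₁ e₂, DiffAt (I.prod 𝓘(ℝ, ℝ)) e₁ p → DiffAt (I.prod 𝓘(ℝ, ℝ)) e₂ p →
        torsion (I.prod 𝓘(ℝ, ℝ)) (productEndo I F Z ξ) e₁ e₂ p = T (e₁ p) (e₂ p)) ∧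
      (∀ a b, T a b = -T b a) ∧
      ∀ a b, T (productEndo I F Z ξ p a) b = -productEndo I F Z ξ p (T a b) := by
  obtain ⟨F', hF'⟩ := h.smooth_endo.hasEndoRepAt p.1
  exact exists_torsionTensor (fun q a => h.productEndo_productEndo a)
    (fun a b => h.productEndo_skew a b) (hF'.productEndo (h.smooth_section.diffAt I p.1))

/-- Integrability is stated for smooth sections; tensoriality extends it to sections differentiable
at one point, which is what is known of `pullBig` and `constBig`. -/
theorem torsion_eq_zero (h : IsAlmostParacontact I F Z ξ)
    (hI : IsIntegrable (I.prod 𝓘(ℝ, ℝ)) (productEndo I F Z ξ))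
    {e₁ e₂ : ∀ p : M × ℝ, BigTangent (I.prod 𝓘(ℝ, ℝ)) p} {p : M × ℝ}
    (h₁ : DiffAt (I.prod 𝓘(ℝ, ℝ)) e₁ p) (h₂ : DiffAt (I.prod 𝓘(ℝ, ℝ)) e₂ p) :
    torsion (I.prod 𝓘(ℝ, ℝ)) (productEndo I F Z ξ) e₁ e₂ p = 0 := by
  obtain ⟨T, hT, -⟩ := h.exists_torsionTensor_productEndo p
  obtain ⟨s₁, hs₁, e₁'⟩ := exists_smoothSection p (e₁ p)
  obtain ⟨s₂, hs₂, e₂'⟩ := exists_smoothSection p (e₂ p)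
  have hs := hT _ _ (hs₁.diffAt _ p) (hs₂.diffAt _ p)
  rw [e₁', e₂'] at hs
  exact (hT _ _ h₁ h₂).trans (hs.symm.trans (hI _ _ hs₁ hs₂ p))

theorem courant_of_isIntegrable (h : IsAlmostParacontact I F Z ξ)
    (hI : IsIntegrable (I.prod 𝓘(ℝ, ℝ)) (productEndo I F Z ξ)) {e₁ e₂ : ∀ x : M, BigTangent I x}
    (h₁ : IsSectionOfImage I F e₁) (h₂ : IsSectionOfImage I F e₂) (p : M × ℝ) :
    courant I (applyEndo I F e₁) (applyEndo I F e₂) p.1 + courant I e₁ e₂ p.1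
      = F p.1 (courant I (applyEndo I F e₁) e₂ p.1 + courant I e₁ (applyEndo I F e₂) p.1) := by
  have := h.torsion_eq_zero hI (p := p) (DiffAt.pullBig (h₁.1.diffAt I p.1))
    (DiffAt.pullBig (h₂.1.diffAt I p.1))
  rw [h.torsion_pullBig h₁ h₂] at this
  exact (inclBig_sub_eq_zero_iff.1 this).1

theorem courant_const_of_isIntegrable (h : IsAlmostParacontact I F Z ξ)
    (hI : IsIntegrable (I.prod 𝓘(ℝ, ℝ)) (productEndo I F Z ξ)) {c d : ℝ}
    {s : ∀ x : M, BigTangent I x} (p : M × ℝ) (hs : DiffAt I s p.1)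
    (hcd : applyEndo (I.prod 𝓘(ℝ, ℝ)) (productEndo I F Z ξ) (constBig I c d) = pullBig I s)
    {e : ∀ x : M, BigTangent I x} (he : IsSectionOfImage I F e) :
    courant I (applyEndo I F e) s p.1 = F p.1 (courant I e s p.1) := by
  have := h.torsion_eq_zero hI (p := p) (DiffAt.pullBig (he.1.diffAt I p.1))
    (diffAt_constBig c d _)
  rw [h.torsion_pullBig_constBig he hs hcd] at this
  exact (inclBig_sub_eq_zero_iff.1 this).1

omit [I.Boundaryless] [FiniteDimensional ℝ E] [T2Space M] [SigmaCompactSpace M] in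
-- By `hTJ` the kernel of `T(·, b)` is `J`-stable, so `submodule_eq_top` applies: first with `b` a
-- generator, then, after exchanging slots by antisymmetry, with `b` arbitrary. The diagonal pairs
-- vanish by antisymmetry.
theorem bilinear_eq_zero (h : IsAlmostParacontact I F Z ξ) {p : M × ℝ}
    {T : BigTangent (I.prod 𝓘(ℝ, ℝ)) p →ₗ[ℝ]
      BigTangent (I.prod 𝓘(ℝ, ℝ)) p →ₗ[ℝ] BigTangent (I.prod 𝓘(ℝ, ℝ)) p}
    (hswap : ∀ a b, T a b = -T b a)
    (hTJ : ∀ a b, T (productEndo I F Z ξ p a) b = -productEndo I F Z ξ p (T a b))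
    (hAA : ∀ a b, T (inclBig I p (F p.1 a)) (inclBig I p (F p.1 b)) = 0)
    (hdξ : ∀ a, T (inclBig I p (F p.1 a)) (constBig I (-1) 0 p) = 0)
    (hdZ : ∀ a, T (inclBig I p (F p.1 a)) (constBig I 0 1 p) = 0)
    (hcc : T (constBig I (-1) 0 p) (constBig I 0 1 p) = 0) (v w) : T v w = 0 := by
  have hself (a) : T a a = 0 := eq_zero_of_eq_neg (V := (E × ℝ) × (E × ℝ →L[ℝ] ℝ)) (hswap a a)
  have hflip {a b} (hab : T a b = 0) : T b a = 0 := by rw [hswap, hab, neg_zero]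
  have hW (b : BigTangent (I.prod 𝓘(ℝ, ℝ)) p) (hb₁ : ∀ a, T (inclBig I p (F p.1 a)) b = 0)
      (hb₂ : T (constBig I (-1) 0 p) b = 0) (hb₃ : T (constBig I 0 1 p) b = 0)
      (v : BigTangent (I.prod 𝓘(ℝ, ℝ)) p) : T v b = 0 := by
    refine h.submodule_eq_top (W := LinearMap.ker (T.flip b)) hb₁ hb₂ hb₃ (fun w hw => ?_) v
    have hw : T w b = 0 := hw
    change T _ b = 0
    rw [hTJ, hw, ContinuousLinearMap.map_zero, neg_zero]
  refine hW _ (fun a => ?_) ?_ ?_ _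
  · exact hflip (hW _ (fun a' => hAA a' a) (hflip (hdξ a)) (hflip (hdZ a)) _)
  · exact hflip (hW _ hdξ (hself _) (hflip hcc) _)
  · exact hflip (hW _ hdZ hcc (hself _) _)

theorem isIntegrable_of_courant (h : IsAlmostParacontact I F Z ξ)
    (hA : ∀ e₁ e₂, IsSectionOfImage I F e₁ → IsSectionOfImage I F e₂ → ∀ x,
        courant I (applyEndo I F e₁) (applyEndo I F e₂) x + courant I e₁ e₂ x
          = F x (courant I (applyEndo I F e₁) e₂ x + courant I e₁ (applyEndo I F e₂) x))
    (hB : ∀ e, IsSectionOfImage I F e → ∀ x,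
        courant I (applyEndo I F e) (fun y => (Z y, 0)) x
          = F x (courant I e (fun y => (Z y, 0)) x))
    (hC : ∀ e, IsSectionOfImage I F e → ∀ x,
        courant I (applyEndo I F e) (fun y => (0, ξ y)) x
          = F x (courant I e (fun y => (0, ξ y)) x)) :
    IsIntegrable (I.prod 𝓘(ℝ, ℝ)) (productEndo I F Z ξ) := by
  intro s₁ s₂ hs₁ hs₂ p
  obtain ⟨T, hT, hswap, hTJ⟩ := h.exists_torsionTensor_productEndo p
  have dZξ := h.smooth_section.diffAt I p.1
  refine (hT _ _ (hs₁.diffAt _ p) (hs₂.diffAt _ p)).trans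
    (h.bilinear_eq_zero hswap hTJ (fun a b => ?_) (fun a => ?_) (fun a => ?_) ?_ _ _)
  · obtain ⟨e₁, he₁, h₁⟩ := h.exists_sectionOfImage ⟨a, rfl⟩
    obtain ⟨e₂, he₂, h₂⟩ := h.exists_sectionOfImage ⟨b, rfl⟩
    rw [← h₁, ← h₂]
    exact (hT _ _ (DiffAt.pullBig (he₁.1.diffAt I p.1))
      (DiffAt.pullBig (he₂.1.diffAt I p.1))).symm.trans (h.torsion_pullBig_eq_zero hA he₁ he₂ p)
  · obtain ⟨e, he, h₁⟩ := h.exists_sectionOfImage ⟨a, rfl⟩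
    rw [← h₁]
    exact (hT _ _ (DiffAt.pullBig (he.1.diffAt I p.1)) (diffAt_constBig _ _ p)).symm.trans
      (h.torsion_pullBig_constBig_eq_zero dZξ.formPart applyEndo_form_eq hC he)
  · obtain ⟨e, he, h₁⟩ := h.exists_sectionOfImage ⟨a, rfl⟩
    rw [← h₁]
    exact (hT _ _ (DiffAt.pullBig (he.1.diffAt I p.1)) (diffAt_constBig _ _ p)).symm.trans
      (h.torsion_pullBig_constBig_eq_zero dZξ.vectorPart applyEndo_vector_eq hB he)
  -- The pair `(-∂_t, dt)` has no hypothesis of its own; its torsion is the bracket of `(0, ξ)` and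
  -- `(Z, 0)`, which `hB` makes vanish.
  · rw [← hT _ _ (diffAt_constBig (-1) 0 p) (diffAt_constBig 0 1 p),
      torsion_constBig dZξ.formPart dZξ.vectorPart applyEndo_form_eq applyEndo_vector_eq,
      h.courant_form_vector hB, ContinuousLinearMap.map_zero]

/-- Integrability of the structure on `M × ℝ`, expressed by brackets of sections over `M`. -/
theorem isIntegrable_iff (h : IsAlmostParacontact I F Z ξ) :
    IsIntegrable (I.prod 𝓘(ℝ, ℝ)) (productEndo I F Z ξ) ↔
      (∀ e₁ e₂, IsSectionOfImage I F e₁ → IsSectionOfImage I F e₂ → ∀ x,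
        courant I (applyEndo I F e₁) (applyEndo I F e₂) x + courant I e₁ e₂ x
          = F x (courant I (applyEndo I F e₁) e₂ x + courant I e₁ (applyEndo I F e₂) x)) ∧
      (∀ e, IsSectionOfImage I F e → ∀ x,
        courant I (applyEndo I F e) (fun y => (Z y, 0)) x
          = F x (courant I e (fun y => (Z y, 0)) x)) ∧
      (∀ e, IsSectionOfImage I F e → ∀ x,
        courant I (applyEndo I F e) (fun y => (0, ξ y)) x
          = F x (courant I e (fun y => (0, ξ y)) x)) :=
  ⟨fun hI => ⟨fun _ _ h₁ h₂ x => h.courant_of_isIntegrable hI h₁ h₂ (x, 0),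
    fun _ he x => h.courant_const_of_isIntegrable hI (x, 0) (h.smooth_section.diffAt I x).vectorPart
      applyEndo_vector_eq he,
    fun _ he x => h.courant_const_of_isIntegrable hI (x, 0) (h.smooth_section.diffAt I x).formPart
      applyEndo_form_eq he⟩,
    fun ⟨hA, hB, hC⟩ => h.isIntegrable_of_courant hA hB hC⟩

end IsAlmostParacontact

end Integrability

/-! ### Translation into the stated conditions. -/

section Characterization

variable {E : Type*} [NormedAddCommGroup E] [NormedSpace ℝ E]
  {H : Type*} [TopologicalSpace H] {I : ModelWithCorners ℝ E H}
  {M : Type*} [TopologicalSpace M] [ChartedSpace H M]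
  {F : ∀ x : M, BigTangent I x →L[ℝ] BigTangent I x} {Z : ∀ x : M, TangentSpace I x}
  {ξ : ∀ x : M, CotangentSpace I x}

theorem lieForm_zero_right (X : ∀ x : M, TangentSpace I x) (x : M) :
    lieForm I X (fun _ => 0) x = 0 := by
  have h₁ : oneFormInChart I (fun y : M => (0 : CotangentSpace I y)) x = 0 := rfl
  have h₂ : extD I (fun y : M => (0 : CotangentSpace I y)) x (X x) = 0 := by
    rw [extD, h₁, fderivWithin_zero]
    exact ContinuousLinearMap.ext fun _ => sub_zero (0 : ℝ)
  rw [lieForm, h₂, differential_const (f := fun y => (0 : CotangentSpace I y) (X y)) (c := 0)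
    (fun _ => rfl), add_zero]

theorem skew_comp_apply_zero (D : E →L[ℝ] E →L[ℝ] ℝ) (φ : E →L[ℝ] E) :
    (D (φ 0) - D.flip (φ 0)).comp φ = 0 := by
  simp

theorem lieForm_zero_left (α : ∀ x : M, CotangentSpace I x) (x : M) :
    lieForm I (fun _ => 0) α x = 0 := by
  have h₂ : extD I α x 0 = 0 := by
    exact skew_comp_apply_zero (E := E) _ _
  rw [lieForm, h₂, differential_const (f := fun y => α y 0) (c := 0) (fun y => (α y).map_zero),
    add_zero]

/-- The Courant bracket and the componentwise Lie derivative differ by `½ d(α(Z))`, which vanishes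
when `α(Z) = 0`, as on `im F`. -/
theorem courant_vector_eq_lieBig {e : ∀ x : M, BigTangent I x} (he : ∀ y, (e y).2 (Z y) = 0)
    (x : M) : courant I (fun y => (Z y, 0)) e x = lieBig I Z e x := by
  refine Prod.ext rfl ?_
  have h : differential I (fun y => (e y).2 (Z y) - (0 : CotangentSpace I y) (e y).1) x = 0 :=
    differential_const (c := 0) (fun y => by rw [he]; exact sub_zero _) x
  change lieForm I Z (fun y => (e y).2) x - lieForm I (fun y => (e y).1) (fun _ => 0) x
    - (1 / 2 : ℝ) • differential I (fun y => (e y).2 (Z y) - (0 : CotangentSpace I y) (e y).1) x = _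
  rw [h, lieForm_zero_right, smul_zero, sub_zero, sub_zero]
  rfl

theorem courant_form_eq_lieForm {e : ∀ x : M, BigTangent I x} (he : ∀ y, ξ y (e y).1 = 0)
    (x : M) : courant I e (fun y => (0, ξ y)) x = (0, lieForm I (fun y => (e y).1) ξ x) := by
  refine Prod.ext ?_ ?_
  · exact congrFun VectorField.mlieBracket_zero_right x
  have h : differential I (fun y => ξ y (e y).1 - (e y).2 0) x = 0 :=
    differential_const (c := 0) (fun y => by rw [he, map_zero, sub_zero]) x
  change lieForm I (fun y => (e y).1) ξ x - lieForm I (fun _ => 0) (fun y => (e y).2) x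
    - (1 / 2 : ℝ) • differential I (fun y => ξ y (e y).1 - (e y).2 0) x = _
  rw [h, lieForm_zero_left, smul_zero, sub_zero, sub_zero]

theorem metricNorm_pair {x : M} (v : TangentSpace I x) (α : CotangentSpace I x) :
    metricNorm I (x := x) (v, α) = Real.sqrt |α v| := by
  rw [metricNorm, metric]
  congr 2
  ring

theorem flat_add_transpose_eq_zero_iff {x : M} {A : BigTangent I x →L[ℝ] BigTangent I x}
    (a : BigTangent I x) : flat I (A a) + transpose I A (flat I a) = 0 ↔
      ∀ b, metric I (A a) b + metric I a (A b) = 0 := by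
  have key (b : BigTangent I x) : (flat I (A a) + transpose I A (flat I a)) b
      = metric I (A a) b + metric I a (A b) := by
    rw [← flat_apply, ← flat_apply]
    rfl
  refine ⟨fun h b => ?_, fun h => ContinuousLinearMap.ext fun b => ?_⟩
  · rw [← key, h]
    rfl
  · rw [key, h]
    rfl

theorem add_sub_eq_neg_iff {V : Type*} [AddCommGroup V] {p q c z : V} :
    p - q + (c - z) = -z ↔ p + c = q := by
  rw [← sub_eq_zero, ← sub_eq_zero (a := p + c)]
  have : p - q + (c - z) - -z = p + c - q := by abel
  rw [this]

theorem pairing_ne_zero {x : M} {v : TangentSpace I x} {α : CotangentSpace I x}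
    (h : metricNorm I (x := x) (v, α) = 1) : α v ≠ 0 := fun h₀ => by
  rw [metricNorm_pair, h₀, abs_zero, Real.sqrt_zero] at h
  exact zero_ne_one h

/-- `(Z, 0)` is an eigenvector of `𝔷` with nonzero eigenvalue `ξ(Z)`, hence lies in the image of
`𝔷`. -/
theorem apply_vector_of_comp {x : M} (hne : ξ x (Z x) ≠ 0)
    (h : (F x).comp (frakZ I Z ξ x) = 0) : F x (Z x, 0) = 0 := by
  have h₁ : F x (ξ x (Z x) • (Z x, 0)) = 0 := by
    have h₂ : frakZ I Z ξ x (Z x, 0) = ξ x (Z x) • (Z x, 0) := by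
      rw [frakZ_apply]
      exact Prod.ext rfl ((zero_smul ℝ (ξ x)).trans (smul_zero (ξ x (Z x))).symm)
    rw [← h₂]
    exact congrArg (fun A : BigTangent I x →L[ℝ] BigTangent I x => A (Z x, 0)) h
  rw [ContinuousLinearMap.map_smul] at h₁
  exact (smul_eq_zero.1 h₁).resolve_left hne

theorem apply_form_of_comp {x : M} (hne : ξ x (Z x) ≠ 0)
    (h : (F x).comp (frakZ I Z ξ x) = 0) : F x (0, ξ x) = 0 := by
  have h₁ : F x (ξ x (Z x) • (0, ξ x)) = 0 := by
    have h₂ : frakZ I Z ξ x (0, ξ x) = ξ x (Z x) • (0, ξ x) := by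
      rw [frakZ_apply]
      refine Prod.ext ?_ rfl
      change ξ x 0 • Z x = ξ x (Z x) • (0 : TangentSpace I x)
      rw [map_zero, zero_smul, smul_zero]
    rw [← h₂]
    exact congrArg (fun A : BigTangent I x →L[ℝ] BigTangent I x => A (0, ξ x)) h
  rw [ContinuousLinearMap.map_smul] at h₁
  exact (smul_eq_zero.1 h₁).resolve_left hne

/-- Settles the sign left open by the norm: at `(Z, 0)` the square relation reads `0 = (1 - ξ(Z))
Z`, and `ξ` is applied to it. -/
theorem pairing_eq_one_of_sq {x : M} (hne : ξ x (Z x) ≠ 0) (hZ : F x (Z x, 0) = 0)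
    (hsq : (F x).comp (F x) = ContinuousLinearMap.id ℝ _ - frakZ I Z ξ x) : ξ x (Z x) = 1 := by
  have h := congrArg (fun A : BigTangent I x →L[ℝ] BigTangent I x => A (Z x, 0)) hsq
  have h₁ : F x (F x (Z x, 0)) = (Z x, 0) - frakZ I Z ξ x (Z x, 0) := h
  rw [hZ, ContinuousLinearMap.map_zero] at h₁
  have h₂ : (0 : TangentSpace I x) = Z x - ξ x (Z x) • Z x := congrArg Prod.fst h₁
  have h₃ := congrArg (ξ x) h₂
  rw [map_zero, map_sub, map_smul, smul_eq_mul] at h₃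
  have h₄ : ξ x (Z x) * (1 - ξ x (Z x)) = 0 := by linarith
  linarith [(mul_eq_zero.1 h₄).resolve_left hne]

variable [IsManifold I ∞ M]

/-- The algebraic part of the characterization of generalized normal para-contact structures. -/
theorem isAlmostParacontact_iff (hF : IsSmoothEndo I F)
    (hZξ : IsSmoothSection I (fun x => (Z x, ξ x))) :
    IsAlmostParacontact I F Z ξ ↔
      (∀ x, (F x).comp (F x) = ContinuousLinearMap.id ℝ _ - frakZ I Z ξ x) ∧
      (∀ x : M, metricNorm I (x := x) (Z x, ξ x) = 1) ∧
      (∀ (x : M) (a : BigTangent I x),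
        flat I (F x a) + transpose I (F x) (flat I a) = 0) ∧
      ∀ x, (F x).comp (frakZ I Z ξ x) = 0 := by
  constructor
  · intro h
    refine ⟨h.sq, fun x => ?_, fun x a => ?_, fun x => ContinuousLinearMap.ext fun a => ?_⟩
    · rw [metricNorm_pair, h.pairing, abs_one, Real.sqrt_one]
    · exact (flat_add_transpose_eq_zero_iff a).2 (h.skew x a)
    · have : frakZ I Z ξ x a = ξ x a.1 • (Z x, 0) + a.2 (Z x) • (0, ξ x) :=
        smul_pair_eq_add (ξ x a.1) (a.2 (Z x)) (Z x) (ξ x)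
      change F x (frakZ I Z ξ x a) = 0
      rw [this, ContinuousLinearMap.map_add, ContinuousLinearMap.map_smul,
        ContinuousLinearMap.map_smul, h.apply_vector, h.apply_form, smul_zero, smul_zero, add_zero]
  · rintro ⟨hsq, hnorm, hflat, hcomp⟩
    have hne (x : M) := pairing_ne_zero (hnorm x)
    have hv (x : M) := apply_vector_of_comp (hne x) (hcomp x)
    exact ⟨hF, hZξ, fun x a => (flat_add_transpose_eq_zero_iff a).1 (hflat x a),
      fun x => pairing_eq_one_of_sq (hne x) (hv x) (hsq x),
      fun x => apply_form_of_comp (hne x) (hcomp x), hv, hsq⟩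

namespace IsAlmostParacontact
variable {e e₁ e₂ : ∀ x : M, BigTangent I x}

/-- Substituting `F² = I - 𝔷` in the last term of the Nijenhuis operator cancels the two occurrences
of `𝔷`. -/
theorem nijenhuis_eq_iff (h : IsAlmostParacontact I F Z ξ) (x : M) :
    nijenhuis I F e₁ e₂ x = -frakZ I Z ξ x (courant I e₁ e₂ x) ↔
      courant I (applyEndo I F e₁) (applyEndo I F e₂) x + courant I e₁ e₂ x
        = F x (courant I (applyEndo I F e₁) e₂ x + courant I e₁ (applyEndo I F e₂) x) := by
  have hsq : F x (F x (courant I e₁ e₂ x))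
      = courant I e₁ e₂ x - frakZ I Z ξ x (courant I e₁ e₂ x) :=
    congrArg (fun A : BigTangent I x →L[ℝ] BigTangent I x => A (courant I e₁ e₂ x)) (h.sq x)
  rw [nijenhuis, hsq]
  exact add_sub_eq_neg_iff

theorem courant_vector_eq_iff [I.Boundaryless] (h : IsAlmostParacontact I F Z ξ)
    (he : IsSectionOfImage I F e) (x : M) :
    courant I (fun y => (Z y, 0)) (applyEndo I F e) x = F x (lieBig I Z e x) ↔
      courant I (applyEndo I F e) (fun y => (Z y, 0)) x
        = F x (courant I e (fun y => (Z y, 0)) x) := by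
  have hv := (h.smooth_section.diffAt I x).vectorPart
  have hZ (y : M) : (e y).2 (Z y) = 0 := by
    obtain ⟨b, hb⟩ := he.2 y
    rw [← hb, h.snd_apply_vector]
  rw [← courant_vector_eq_lieBig hZ,
    courant_swap hv ((h.sectionOfImage_applyEndo he.1).1.diffAt I x),
    courant_swap hv (he.1.diffAt I x), ContinuousLinearMap.map_neg]
  exact neg_inj

theorem courant_form_eq_iff (h : IsAlmostParacontact I F Z ξ)
    (he : IsSectionOfImage I F e) (x : M) :
    courant I (applyEndo I F e) (fun y => (0, ξ y)) x
        = F x (0, lieForm I (fun y => (e y).1) ξ x) ↔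
      courant I (applyEndo I F e) (fun y => (0, ξ y)) x
        = F x (courant I e (fun y => (0, ξ y)) x) := by
  have hξ (y : M) : ξ y (e y).1 = 0 := by
    obtain ⟨b, hb⟩ := he.2 y
    rw [← hb, h.form_apply_fst]
  rw [← courant_form_eq_lieForm hξ]

end IsAlmostParacontact

theorem isNormalParacontact_iff [I.Boundaryless] [FiniteDimensional ℝ E] [T2Space M]
    [SigmaCompactSpace M] (hF : IsSmoothEndo I F)
    (hZξ : IsSmoothSection I (fun x => (Z x, ξ x))) :
    IsNormalParacontact I F Z ξ ↔
      ((∀ x, (F x).comp (F x) =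
          ContinuousLinearMap.id ℝ _ - frakZ I Z ξ x) ∧
        (∀ e₁ e₂, IsSectionOfImage I F e₁ →
          IsSectionOfImage I F e₂ → ∀ x,
          nijenhuis I F e₁ e₂ x =
            -frakZ I Z ξ x
              (courant I e₁ e₂ x))) ∧
      ((∀ x : M, metricNorm I (x := x) (Z x, ξ x) = 1) ∧
        (∀ e, IsSectionOfImage I F e → ∀ x,
          courant I (fun y => (Z y, 0))
              (applyEndo I F e) x =
            F x (lieBig I Z e x))) ∧
      ((∀ (x : M) (a : BigTangent I x),
          flat I (F x a) +
            transpose I (F x)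
              (flat I a) = 0) ∧
        (∀ x, (F x).comp (frakZ I Z ξ x) = 0) ∧
        (∀ e, IsSectionOfImage I F e → ∀ x,
          courant I
              (applyEndo I F e) (fun y => (0, ξ y)) x =
            F x (0, lieForm I (fun y => (e y).1) ξ x))) := by
  constructor
  · rintro ⟨h, hI⟩
    obtain ⟨hA, hB, hC⟩ := h.isIntegrable_iff.1 hI
    obtain ⟨hsq, hnorm, hflat, hcomp⟩ := (isAlmostParacontact_iff hF hZξ).1 h
    exact ⟨⟨hsq, fun e₁ e₂ h₁ h₂ x => (h.nijenhuis_eq_iff x).2 (hA e₁ e₂ h₁ h₂ x)⟩,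
      ⟨hnorm, fun e he x => (h.courant_vector_eq_iff he x).2 (hB e he x)⟩,
      hflat, hcomp, fun e he x => (h.courant_form_eq_iff he x).2 (hC e he x)⟩
  · rintro ⟨⟨hsq, hA⟩, ⟨hnorm, hB⟩, hflat, hcomp, hC⟩
    have h := (isAlmostParacontact_iff hF hZξ).2 ⟨hsq, hnorm, hflat, hcomp⟩
    exact ⟨h, h.isIntegrable_of_courant
      (fun e₁ e₂ h₁ h₂ x => (h.nijenhuis_eq_iff x).1 (hA e₁ e₂ h₁ h₂ x))
      (fun e he x => (h.courant_vector_eq_iff he x).1 (hB e he x))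
      (fun e he x => (h.courant_form_eq_iff he x).1 (hC e he x))⟩

end Characterization

end GenParacontact

end

/-- Characterization of generalized normal para-contact structures on an odd-dimensional manifold:
`F` is a smooth endomorphism of `TM ⊕ T*M`, `(Z, ξ)` a smooth section of it and `𝔷 = Z ⊙ ξ`. -/
theorem theorem3p2 {n : ℕ} {M : Type*} [TopologicalSpace M]
    [ChartedSpace (EuclideanSpace ℝ (Fin (2 * n + 1))) M]
    [IsManifold (𝓡 (2 * n + 1)) ∞ M] [T2Space M] [SecondCountableTopology M]
    (F : ∀ x : M, GenParacontact.BigTangent (𝓡 (2 * n + 1)) x →L[ℝ]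
      GenParacontact.BigTangent (𝓡 (2 * n + 1)) x)
    (hF : GenParacontact.IsSmoothEndo (𝓡 (2 * n + 1)) F)
    (Z : ∀ x : M, TangentSpace (𝓡 (2 * n + 1)) x)
    (ξ : ∀ x : M, GenParacontact.CotangentSpace (𝓡 (2 * n + 1)) x)
    (hZξ : GenParacontact.IsSmoothSection (𝓡 (2 * n + 1)) (fun x => (Z x, ξ x))) :
    GenParacontact.IsNormalParacontact (𝓡 (2 * n + 1)) F Z ξ ↔
      -- (i) `F² = I - 𝔷`, and `N_F = -𝔷 ⟦·, ·⟧` on sections of `im F`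
      ((∀ x, (F x).comp (F x) =
          ContinuousLinearMap.id ℝ _ - GenParacontact.frakZ (𝓡 (2 * n + 1)) Z ξ x) ∧
        (∀ e₁ e₂, GenParacontact.IsSectionOfImage (𝓡 (2 * n + 1)) F e₁ →
          GenParacontact.IsSectionOfImage (𝓡 (2 * n + 1)) F e₂ → ∀ x,
          GenParacontact.nijenhuis (𝓡 (2 * n + 1)) F e₁ e₂ x =
            -GenParacontact.frakZ (𝓡 (2 * n + 1)) Z ξ x
              (GenParacontact.courant (𝓡 (2 * n + 1)) e₁ e₂ x))) ∧
      -- (ii) `‖Z ⊕ ξ‖_g = 1`, and `⟦(Z, 0), F e⟧ = F (L_Z e)` for sections `e` of `im F`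
      ((∀ x : M, GenParacontact.metricNorm (𝓡 (2 * n + 1)) (x := x) (Z x, ξ x) = 1) ∧
        (∀ e, GenParacontact.IsSectionOfImage (𝓡 (2 * n + 1)) F e → ∀ x,
          GenParacontact.courant (𝓡 (2 * n + 1)) (fun y => (Z y, 0))
              (GenParacontact.applyEndo (𝓡 (2 * n + 1)) F e) x =
            F x (GenParacontact.lieBig (𝓡 (2 * n + 1)) Z e x))) ∧
      -- (iii) `♭_g ∘ F + F^t ∘ ♭_g = 0`, `F ∘ 𝔷 = 0`, and `⟦F (X, α), (0, ξ)⟧ = F (0, L_X ξ)` for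
      -- sections `(X, α)` of `im F`
      ((∀ (x : M) (a : GenParacontact.BigTangent (𝓡 (2 * n + 1)) x),
          GenParacontact.flat (𝓡 (2 * n + 1)) (F x a) +
            GenParacontact.transpose (𝓡 (2 * n + 1)) (F x)
              (GenParacontact.flat (𝓡 (2 * n + 1)) a) = 0) ∧
        (∀ x, (F x).comp (GenParacontact.frakZ (𝓡 (2 * n + 1)) Z ξ x) = 0) ∧
        (∀ e, GenParacontact.IsSectionOfImage (𝓡 (2 * n + 1)) F e → ∀ x,
          GenParacontact.courant (𝓡 (2 * n + 1))
              (GenParacontact.applyEndo (𝓡 (2 * n + 1)) F e) (fun y => (0, ξ y)) x =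
            F x (0, GenParacontact.lieForm (𝓡 (2 * n + 1)) (fun y => (e y).1) ξ x))) := by
  -- Local compactness and second countability give the σ-compactness needed for partitions of
  -- unity.
  have : LocallyCompactSpace M :=
    ChartedSpace.locallyCompactSpace (EuclideanSpace ℝ (Fin (2 * n + 1))) M
  exact GenParacontact.isNormalParacontact_iff hF hZξ
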